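/- Let $\boldsymbol{L}^4$ be Lorentz–Minkowski space with inner product $\langle z,w\rangle=-z^0w^0+z^1w^1+z^2w^2+z^3w^3$, and let $Q^3_\pm=\{z\in\boldsymbol{L}^4:\langle z,z\rangle=0,\ \pm z^0>0\}$ be the upper and lower lightcones. An isometric immersion of a smooth Riemannian $2$-manifold $(M^2,g)$ into $Q^3_+$ is a smooth immersion $x:M^2\to Q^3_+$ with $\langle dx,dx\rangle=g$. The dual of $x$ is the smooth map $y:M^2\to Q^3_-$ such that $\langle x,y\rangle=1$ and $\langle dx,y\rangle=\langle x,dy\rangle=0$, and the second fundamental form of $x$ is the tensor $-\langle dx,dy\rangle$. Proposition. Let $(M^2,g)$ be a $1$-connected (i.e. connected and simply connected) smooth Riemannian $2$-manifold with Levi-Civita connection $\nabla$ and Gaussian curvature $K$. (1) Let $I\!I$ be a smooth symmetric covariant $2$-tensor on $M^2$ satisfying the Codazzi equation (i.e. $\nabla I\!I$ is a symmetric $3$-tensor). If $K=-\operatorname{trace}_g(I\!I)$ on $M^2$, then there exists an isometric immersion $x:(M^2,g)\to Q^3_+$ whose second fundamental form is $I\!I$. (2) Conversely, every isometric immersion $x:(M^2,g)\to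 Q^3_+$ is given in this manner: it has a well-defined (existing and unique) second fundamental form $I\!I$, which is a smooth symmetric covariant $2$-tensor satisfying the Codazzi equation and $K=-\operatorname{trace}_g(I\!I)$. -/

import Mathlib

open scoped Manifold ContDiff Bundle

noncomputable section

namespace LightconeSurface

/-- The model space of `2`-manifolds. -/
abbrev Plane : Type := EuclideanSpace ℝ (Fin 2)

/-- The underlying vector space of the Lorentz-Minkowski space `L⁴`. -/
abbrev L4 : Type := EuclideanSpace ℝ (Fin 4)

/-- The Lorentzian inner product of signature `(-,+,+,+)` on `L⁴`. -/
def lorentz (z w : L4) : ℝ :=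
  -(z 0 * w 0) + z 1 * w 1 + z 2 * w 2 + z 3 * w 3

/-- The upper lightcone `Q³₊`. -/
def Qplus : Set L4 := {z | lorentz z z = 0 ∧ 0 < z 0}

/-- The lower lightcone `Q³₋`. -/
def Qminus : Set L4 := {z | lorentz z z = 0 ∧ z 0 < 0}

/-! ### Local coordinate formulas

Here `G`, `H` are matrix-valued functions of the coordinates `u = (u⁰, u¹)`: the components of a
metric and of a symmetric covariant `2`-tensor. -/

/-- The partial derivative `∂f/∂uᵏ` at `u`. -/
def pd (k : Fin 2) (f : Plane → ℝ) (u : Plane) : ℝ :=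
  fderiv ℝ f u (EuclideanSpace.single k 1)

/-- The Christoffel symbol `Γᵏᵢⱼ` of the Levi-Civita connection of `G`. -/
def christoffel (G : Plane → Matrix (Fin 2) (Fin 2) ℝ) (k i j : Fin 2) (u : Plane) : ℝ :=
  (1 / 2) * ∑ l, (G u)⁻¹ k l *
    (pd i (fun w => G w j l) u + pd j (fun w => G w i l) u - pd l (fun w => G w i j) u)

/-- The component `(∇ H)ₖᵢⱼ = (∇_{∂ₖ} H)(∂ᵢ, ∂ⱼ)` of the covariant derivative of `H` with respect
to the Levi-Civita connection of `G`. -/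
def covDerivTensor (G H : Plane → Matrix (Fin 2) (Fin 2) ℝ) (k i j : Fin 2) (u : Plane) : ℝ :=
  pd k (fun w => H w i j) u
    - ∑ l, christoffel G l k i u * H u l j - ∑ l, christoffel G l k j u * H u i l

/-- The component `Rˡ` of the curvature tensor of `G`: with
`R(X,Y) = ∇_X ∇_Y - ∇_Y ∇_X - ∇_{[X,Y]}`, one has
`R(∂ᵢ, ∂ⱼ) ∂ₖ = ∑ l, riemannTensor G l k i j • ∂ₗ`. -/
def riemannTensor (G : Plane → Matrix (Fin 2) (Fin 2) ℝ) (l k i j : Fin 2) (u : Plane) : ℝ :=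
  pd i (christoffel G l j k) u - pd j (christoffel G l i k) u
    + ∑ m, (christoffel G l i m u * christoffel G m j k u
      - christoffel G l j m u * christoffel G m i k u)

/-- The Gaussian curvature `⟨R(∂₀, ∂₁) ∂₁, ∂₀⟩ / det G` of `G`. -/
def gaussCoord (G : Plane → Matrix (Fin 2) (Fin 2) ℝ) (u : Plane) : ℝ :=
  (∑ l, G u 0 l * riemannTensor G l 1 0 1 u) / (G u).det

/-! ### Tensors on a `2`-manifold -/

section Manifold

variable {M : Type*} [TopologicalSpace M] [ChartedSpace Plane M]

/-- The coordinate vector `∂/∂uⁱ` of the chart `φ`, at the point with coordinates `u`. -/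
def coordVec (φ : OpenPartialHomeomorph M Plane) (i : Fin 2) (u : Plane) :
    TangentSpace (𝓡 2) (φ.symm u) :=
  mfderiv (𝓡 2) (𝓡 2) φ.symm u (EuclideanSpace.single i (1 : ℝ) : Plane)

/-- The components `Tᵢⱼ = T(∂ᵢ, ∂ⱼ)`, in the chart `φ`, of a field `T` of bilinear forms. -/
def components (T : ∀ p : M, TangentSpace (𝓡 2) p →L[ℝ] TangentSpace (𝓡 2) p →L[ℝ] ℝ)
    (φ : OpenPartialHomeomorph M Plane) (u : Plane) : Matrix (Fin 2) (Fin 2) ℝ :=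
  Matrix.of fun i j => T (φ.symm u) (coordVec φ i u) (coordVec φ j u)

variable [IsManifold (𝓡 2) ∞ M]

variable (M) in
/-- A smooth Riemannian metric on the `2`-manifold `M`. -/
abbrev Metric : Type _ :=
  Bundle.ContMDiffRiemannianMetric (𝓡 2) ∞ Plane (fun p : M => TangentSpace (𝓡 2) p)

variable (M) in
/-- A smooth symmetric covariant `2`-tensor on the `2`-manifold `M`. -/
structure SymTensor where
  toFun (p : M) : TangentSpace (𝓡 2) p →L[ℝ] TangentSpace (𝓡 2) p →L[ℝ] ℝ
  symm (p : M) (v w : TangentSpace (𝓡 2) p) : toFun p v w = toFun p w v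
  contMDiff : ContMDiff (𝓡 2) ((𝓡 2).prod 𝓘(ℝ, Plane →L[ℝ] Plane →L[ℝ] ℝ)) ∞
    (fun p => Bundle.TotalSpace.mk' (Plane →L[ℝ] Plane →L[ℝ] ℝ)
      (E := fun p : M => TangentSpace (𝓡 2) p →L[ℝ] TangentSpace (𝓡 2) p →L[ℝ] ℝ) p (toFun p))

/-- The Codazzi equation: the covariant derivative `∇ h` with respect to the Levi-Civita connection
of `g` is a symmetric `3`-tensor, that is, in every smooth chart its components are invariant under
the two transpositions which generate all permutations of the three indices. -/
def IsCodazzi (g : Metric M) (h : SymTensor M) : Prop :=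
  ∀ φ ∈ IsManifold.maximalAtlas (𝓡 2) ∞ M, ∀ u ∈ φ.target, ∀ k i j : Fin 2,
    covDerivTensor (components g.inner φ) (components h.toFun φ) k i j u
        = covDerivTensor (components g.inner φ) (components h.toFun φ) i k j u ∧
      covDerivTensor (components g.inner φ) (components h.toFun φ) k i j u
        = covDerivTensor (components g.inner φ) (components h.toFun φ) k j i u

/-- `K` is the Gaussian curvature of `g`: in every smooth chart it is given by the coordinate
formula (whose value at a point does not depend on the chart). -/
def IsGaussianCurvature (g : Metric M) (K : M → ℝ) : Prop :=
  ∀ φ ∈ IsManifold.maximalAtlas (𝓡 2) ∞ M, ∀ p ∈ φ.source,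
    K p = gaussCoord (components g.inner φ) (φ p)

/-- The `i`-th vector of the standard basis of the tangent space at `p`, which is a copy of the
model space `ℝ²`. -/
def stdVec (p : M) (i : Fin 2) : TangentSpace (𝓡 2) p :=
  (EuclideanSpace.single i (1 : ℝ) : Plane)

/-- The trace `∑ gⁱʲ hᵢⱼ` of `h` with respect to `g`, as a function on `M`. (It is computed in one
basis of each tangent space; its value does not depend on the basis.) -/
def metricTrace (g : Metric M) (h : SymTensor M) (p : M) : ℝ :=
  ((Matrix.of fun i j => g.inner p (stdVec p i) (stdVec p j) : Matrix (Fin 2) (Fin 2) ℝ)⁻¹ *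
    Matrix.of fun i j => h.toFun p (stdVec p i) (stdVec p j)).trace

/-- `x` is an isometric immersion of `(M, g)` into the lightcone `Q³₊`. -/
structure IsIsometricImmersion (g : Metric M) (x : M → L4) : Prop where
  contMDiff : ContMDiff (𝓡 2) 𝓘(ℝ, L4) ∞ x
  mem_Qplus (p : M) : x p ∈ Qplus
  injective_mvfderiv (p : M) : Function.Injective (mvfderiv (𝓡 2) x p)
  isometric (p : M) (v w : TangentSpace (𝓡 2) p) :
    lorentz (mvfderiv (𝓡 2) x p v) (mvfderiv (𝓡 2) x p w) = g.inner p v w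

/-- `y` is the dual of `x`: a smooth map into the lower lightcone `Q³₋` such that `⟨x, y⟩ = 1` and
`⟨dx, y⟩ = ⟨dy, x⟩ = 0`. -/
structure IsDual (x y : M → L4) : Prop where
  contMDiff : ContMDiff (𝓡 2) 𝓘(ℝ, L4) ∞ y
  mem_Qminus (p : M) : y p ∈ Qminus
  lorentz_eq_one (p : M) : lorentz (x p) (y p) = 1
  lorentz_dx (p : M) (v : TangentSpace (𝓡 2) p) : lorentz (mvfderiv (𝓡 2) x p v) (y p) = 0
  lorentz_dy (p : M) (v : TangentSpace (𝓡 2) p) : lorentz (mvfderiv (𝓡 2) y p v) (x p) = 0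

/-- `h` is the second fundamental form `-⟨dx, dy⟩` of `x`, where `y` is the dual of `x`. -/
def IsSecondFundamentalForm (x : M → L4) (h : SymTensor M) : Prop :=
  ∃ y : M → L4, IsDual x y ∧ ∀ (p : M) (v w : TangentSpace (𝓡 2) p),
    h.toFun p v w = -lorentz (mvfderiv (𝓡 2) x p v) (mvfderiv (𝓡 2) y p w)

end Manifold

end LightconeSurface

end

/-! In a chart, the moving frame `(x, ∂₀x, ∂₁x, y)` of an immersion into the lightcone satisfies a
linear system `∂ᵢF = AᵢF` whose matrices `connForm` involve only the metric and the second
fundamental form (`IsCoordSol.vpd_coordFrame`). The system is integrable when the curvature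
`connCurv` of this connection vanishes, and that is equivalent to Codazzi together with `K =
-trace`. The tangential rows of the `x`-column express Codazzi, and the last row repeats it with an
index raised. The tangential block becomes antisymmetric once an index is lowered, so in dimension
two it is a single scalar, proportional to `K + trace`. The remaining entries vanish identically.

Existence. A flat linear system has local solutions with arbitrary initial value
(`exists_ball_hasFDerivAt_eq_apply`, a Frobenius theorem proved by solving ODEs along rays).
Starting from a frame with the prescribed Gram matrix, the Gram matrix stays the prescribed one,
because the defect solves a linear system with zero initial value (`gram_eq_gramForm`). This gives
local immersions (`exists_isCoordSol`). Any two of them differ near a point by a unique Lorentz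
isometry (`exists_lorentzGroup_eventually_eq`, `lorentzGroup_eq_of_eventually`), so the transition
isometries form a locally constant cocycle. On a simply connected surface such a cocycle splits
(`exists_splitting_of_locallyConstant_cocycle`), and the corrected pieces glue. The time component
of the result never vanishes, so a global sign puts it in the upper cone.

Converse. The dual is determined pointwise by linear algebra and depends smoothly on the frame
(`IsIsometricImmersion.exists_isDual`). Symmetry of `-⟨dx, dy⟩` is the symmetry of second
derivatives of `x`. Equality of mixed partials of the frame, which is a basis, forces `connCurv = 0`
(`IsCoordSol.connCurv_eq_zero`), from which Codazzi and the curvature formula are read off. -/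

namespace LightconeSurface

/-! ### Frobenius theorem for flat linear total differential equations, in Banach spaces. -/

section Frobenius

set_option maxSynthPendingDepth 3


open Set Metric

variable {E V W : Type*} [NormedAddCommGroup E] [NormedSpace ℝ E] [NormedAddCommGroup V]
  [NormedSpace ℝ V] [NormedAddCommGroup W] [NormedSpace ℝ W]

theorem add_smul_mem_ball {c u : E} {r t : ℝ} (hu : u ∈ ball (0 : E) r) (ht : t ∈ Icc (0 : ℝ) 1) :
    c + t • u ∈ ball c r := by
  rw [mem_ball_zero_iff] at hu
  rw [mem_ball, dist_eq_norm, add_sub_cancel_left, norm_smul, Real.norm_eq_abs, abs_of_nonneg ht.1]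
  nlinarith [ht.1, ht.2, norm_nonneg u]

theorem hasDerivAt_ray (c u : E) (t : ℝ) : HasDerivAt (fun s : ℝ => c + s • u) u t := by
  simpa using ((hasDerivAt_id t).smul_const u).const_add c

/-- A differentiable function on a ball, vanishing at the centre, whose derivative is bounded by a
multiple of the function, is zero. -/
theorem eq_zero_of_norm_fderiv_le_mul_norm {S : E → W} {S' : E → E →L[ℝ] W} {c : E} {r K : ℝ}
    (hS : ∀ x ∈ ball c r, HasFDerivAt S (S' x) x) (hK : ∀ x ∈ ball c r, ‖S' x‖ ≤ K * ‖S x‖)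
    (hc : S c = 0) {x : E} (hx : x ∈ ball c r) : S x = 0 := by
  have hu : x - c ∈ ball (0 : E) r := by simpa [dist_eq_norm] using hx
  have hd : ∀ t ∈ Icc (0 : ℝ) 1, HasDerivAt (fun s : ℝ => S (c + s • (x - c)))
      (S' (c + t • (x - c)) (x - c)) t := fun t ht =>
    (hS _ (add_smul_mem_ball hu ht)).comp_hasDerivAt t (hasDerivAt_ray c (x - c) t)
  have := eq_zero_of_abs_deriv_le_mul_abs_self_of_eq_zero_right (K := K * ‖x - c‖)
    (f := fun s : ℝ => S (c + s • (x - c))) (a := 0) (b := 1)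
    (fun t ht => (hd t ht).continuousAt.continuousWithinAt)
    (fun t ht => (hd t (Ico_subset_Icc_self ht)).hasDerivWithinAt) (by simpa using hc)
    (fun t ht => by
      have h1 := hK _ (add_smul_mem_ball hu (Ico_subset_Icc_self ht))
      calc _ ≤ ‖S' (c + t • (x - c))‖ * ‖x - c‖ := ContinuousLinearMap.le_opNorm _ _
        _ ≤ K * ‖S (c + t • (x - c))‖ * ‖x - c‖ := by gcongr
        _ = _ := by ring) 1 (by simp)
  simpa using this

/-- The bound `M * r ≤ 1 / 2` lets Picard-Lindelöf reach time one in a single step: on the ball of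
radius `‖v‖ + 1` about `v` the field has norm at most `(2‖v‖ + 1) / 2 ≤ ‖v‖ + 1`, so a solution
cannot leave that ball before time one. -/
theorem exists_ray_solution [CompleteSpace V] {A : E → E →L[ℝ] V →L[ℝ] V} {c u : E} {r M : ℝ}
    (hA : ContinuousOn A (ball c r)) (hM : ∀ x ∈ ball c r, ‖A x‖ ≤ M) (hMr : M * r ≤ 1 / 2)
    (v : V) (hu : u ∈ ball (0 : E) r) :
    ∃ φ : ℝ → V, φ 0 = v ∧ ∀ t ∈ Icc (0 : ℝ) 1,
      HasDerivWithinAt φ (A (c + t • u) u (φ t)) (Icc 0 1) t := by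
  have hu' : ‖u‖ < r := by simpa using hu
  have hM0 : 0 ≤ M := (norm_nonneg _).trans (hM c (mem_ball_self ((norm_nonneg u).trans_lt hu')))
  have hop : ∀ t ∈ Icc (0 : ℝ) 1, ‖A (c + t • u) u‖ ≤ 1 / 2 := fun t ht =>
    calc _ ≤ ‖A (c + t • u)‖ * ‖u‖ := ContinuousLinearMap.le_opNorm _ _
      _ ≤ M * r := by gcongr; exact hM _ (add_smul_mem_ball hu ht)
      _ ≤ _ := hMr
  have hpl : IsPicardLindelof (fun t x => A (c + t • u) u x) (tmin := 0) (tmax := 1)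
      ⟨0, by simp⟩ v (‖v‖₊ + 1) 0 (‖v‖₊ + 1) (1 / 2) := by
    refine ⟨fun t ht => ?_, fun x _ => ?_, fun t ht x hx => ?_, by simp⟩
    · refine LipschitzWith.lipschitzOnWith ?_
      refine (A (c + t • u) u).lipschitz.weaken ?_
      rw [← NNReal.coe_le_coe]; simpa using hop t ht
    · have h1 : ContinuousOn (fun t : ℝ => A (c + t • u)) (Icc 0 1) :=
        hA.comp (by fun_prop) (fun t ht => add_smul_mem_ball hu ht)
      exact (h1.clm_apply continuousOn_const).clm_apply continuousOn_const
    · have h2 : ‖x‖ ≤ ‖v‖ + (‖v‖ + 1) := by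
        have : ‖x - v‖ ≤ ‖v‖ + 1 := by simpa [dist_eq_norm] using hx
        calc ‖x‖ = ‖v + (x - v)‖ := by simp
          _ ≤ _ := (norm_add_le _ _).trans (by gcongr)
      calc _ ≤ ‖A (c + t • u) u‖ * ‖x‖ := ContinuousLinearMap.le_opNorm _ _
        _ ≤ 1 / 2 * (‖v‖ + (‖v‖ + 1)) := by gcongr; exact hop t ht
        _ ≤ _ := by push_cast; simp; linarith
  exact hpl.exists_eq_forall_mem_Icc_hasDerivWithinAt₀

/-- Comparison of the solutions of a flat linear total differential equation along two
neighbouring rays. -/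
theorem norm_ray_solution_sub_le {A : E → E →L[ℝ] V →L[ℝ] V}
    {DA : E → E →L[ℝ] E →L[ℝ] V →L[ℝ] V} {c : E} {r M M₁ K B : ℝ}
    (hA : ∀ x ∈ ball c r, HasFDerivAt A (DA x) x)
    (hM : ∀ x ∈ ball c r, ‖A x‖ ≤ M) (hMr : M * r ≤ 1 / 2)
    (hM₁ : ∀ x ∈ ball c r, ‖DA x‖ ≤ M₁)
    (hK0 : 0 ≤ K) (hK : ∀ x ∈ ball c r, ∀ y ∈ ball c r, ‖DA y - DA x‖ ≤ K * ‖y - x‖)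
    (flat : ∀ x ∈ ball c r, ∀ u w v,
      DA x u w v + A x w (A x u v) = DA x w u v + A x u (A x w v))
    {u w : E} (hu : u ∈ ball (0 : E) r) (hw : u + w ∈ ball (0 : E) r) {φ ψ : ℝ → V}
    (hφB : ∀ t ∈ Icc (0 : ℝ) 1, ‖φ t‖ ≤ B) (h0 : ψ 0 = φ 0)
    (hφ : ∀ t ∈ Icc (0 : ℝ) 1, HasDerivWithinAt φ (A (c + t • u) u (φ t)) (Icc 0 1) t)
    (hψ : ∀ t ∈ Icc (0 : ℝ) 1,
      HasDerivWithinAt ψ (A (c + t • (u + w)) (u + w) (ψ t)) (Icc 0 1) t) :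
    ‖ψ 1 - φ 1 - A (c + u) w (φ 1)‖
      ≤ (K * r + M₁ + M₁ * r * M + M * M) * B * (Real.exp 1 - 1) * ‖w‖ ^ 2 := by
  have hu' : ‖u‖ < r := by simpa using hu
  have hr : 0 < r := (norm_nonneg u).trans_lt hu'
  have hcb : c ∈ ball c r := mem_ball_self hr
  have hM0 : 0 ≤ M := (norm_nonneg _).trans (hM c hcb)
  have hM10 : 0 ≤ M₁ := (norm_nonneg _).trans (hM₁ c hcb)
  have hB0 : 0 ≤ B := (norm_nonneg _).trans (hφB 0 (by simp))
  -- First-order prediction for `ψ`: at time `t` the two rays are `t • w` apart, and the solution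
  -- sought has derivative `A` applied to itself. It remains to bound `ψ - P` by Grönwall with a
  -- forcing term quadratic in `w`.
  set P : ℝ → V := fun t => φ t + t • A (c + t • u) w (φ t) with hP
  have hAt : ∀ t ∈ Icc (0 : ℝ) 1,
      HasDerivWithinAt (fun s : ℝ => A (c + s • u)) (DA (c + t • u) u) (Icc 0 1) t := fun t ht =>
    ((hA _ (add_smul_mem_ball hu ht)).comp_hasDerivAt t (hasDerivAt_ray c u t)).hasDerivWithinAt
  have hPd : ∀ t ∈ Icc (0 : ℝ) 1, HasDerivWithinAt P
      (A (c + t • u) u (φ t) + (t • (DA (c + t • u) u w (φ t)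
        + A (c + t • u) w (A (c + t • u) u (φ t))) + A (c + t • u) w (φ t))) (Icc 0 1) t := by
    intro t ht
    have h1 := ((hAt t ht).clm_apply (hasDerivWithinAt_const t _ w)).clm_apply (hφ t ht)
    have h2 := (hφ t ht).add ((hasDerivWithinAt_id t _).smul h1)
    refine h2.congr_deriv ?_
    simp
  have key : ∀ t ∈ Icc (0 : ℝ) 1, ‖ψ t - P t‖ ≤
      gronwallBound 0 1 ((K * r + M₁ + M₁ * r * M + M * M) * B * ‖w‖ ^ 2) (t - 0) := by
    refine norm_le_gronwallBound_of_norm_deriv_right_le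
      (f := fun t => ψ t - P t) (f' := fun t => A (c + t • (u + w)) (u + w) (ψ t) -
      (A (c + t • u) u (φ t) + (t • (DA (c + t • u) u w (φ t)
        + A (c + t • u) w (A (c + t • u) u (φ t))) + A (c + t • u) w (φ t))))
      (fun t ht => ((hψ t ht).sub (hPd t ht)).continuousWithinAt)
      (fun t ht => ?_) (by simp [hP, h0]) (fun t ht => ?_)
    · refine ((hψ t (Ico_subset_Icc_self ht)).sub
        (hPd t (Ico_subset_Icc_self ht))).mono_of_mem_nhdsWithin ?_
      exact Icc_mem_nhdsGE_of_mem ht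
    · replace ht := Ico_subset_Icc_self ht
      have hx := add_smul_mem_ball (c := c) hu ht
      have hy := add_smul_mem_ball (c := c) hw ht
      set x := c + t • u with hxdef
      set y := c + t • (u + w) with hydef
      have hyx : y - x = t • w := by simp [hxdef, hydef, smul_add]
      have htw : ‖t • w‖ ≤ ‖w‖ := by
        rw [norm_smul, Real.norm_eq_abs, abs_of_nonneg ht.1]
        exact mul_le_of_le_one_left (norm_nonneg _) ht.2
      have hseg : segment ℝ x y ⊆ ball c r := (convex_ball c r).segment_subset hx hy
      have d1 : ‖A y - A x‖ ≤ M₁ * ‖w‖ := by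
        have := (convex_ball c r).norm_image_sub_le_of_norm_hasFDerivWithin_le
          (fun z hz => (hA z hz).hasFDerivWithinAt) hM₁ hx hy
        rw [hyx] at this
        exact this.trans (by gcongr)
      have d2 : ‖A y - A x - t • DA x w‖ ≤ K * ‖w‖ ^ 2 := by
        have h3 : ∀ z ∈ segment ℝ x y, ‖DA z - DA x‖ ≤ K * ‖y - x‖ := by
          intro z hz
          refine (hK x hx z (hseg hz)).trans ?_
          gcongr
          rw [segment_eq_image'] at hz
          obtain ⟨θ, hθ, rfl⟩ := hz
          rw [add_sub_cancel_left, norm_smul, Real.norm_eq_abs, abs_of_nonneg hθ.1]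
          exact mul_le_of_le_one_left (norm_nonneg _) hθ.2
        have := (convex_segment x y).norm_image_sub_le_of_norm_hasFDerivWithin_le'
          (fun z hz => (hA z (hseg hz)).hasFDerivWithinAt) h3 (left_mem_segment ℝ x y)
          (right_mem_segment ℝ x y)
        rw [hyx, map_smul] at this
        refine this.trans ?_
        calc K * ‖t • w‖ * ‖t • w‖ ≤ K * ‖w‖ * ‖w‖ := by gcongr
          _ = _ := by ring
      have hf := flat x hx u w (φ t)
      -- Flatness exchanges `DA x u w` for `DA x w u`, after which all terms of first order in `w`
      -- cancel. What is left is a homogeneous term in `ψ - P` and four terms of second order in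
      -- `w`.
      have e1 : A y (u + w) (ψ t) - (A x u (φ t) + (t • (DA x u w (φ t)
          + A x w (A x u (φ t))) + A x w (φ t))) = A y (u + w) (ψ t - P t)
          + ((A y - A x - t • DA x w) u (φ t) + (A y - A x) w (φ t)
            + t • (A y - A x) u (A x w (φ t)) + t • A y w (A x w (φ t))) := by
        rw [hf]
        simp only [hP, ← hxdef, map_sub, map_add, map_smul, sub_apply,
          add_apply, smul_apply, smul_add, smul_sub]
        abel
      rw [e1]
      have b0 : ‖A y (u + w) (ψ t - P t)‖ ≤ 1 * ‖ψ t - P t‖ := by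
        have hw' : ‖u + w‖ < r := by simpa using hw
        calc _ ≤ ‖A y‖ * ‖u + w‖ * ‖ψ t - P t‖ := ContinuousLinearMap.le_opNorm₂ _ _ _
          _ ≤ M * r * ‖ψ t - P t‖ := by gcongr; exact hM y hy
          _ ≤ _ := by gcongr; linarith
      have hn : ‖φ t‖ ≤ B := hφB t ht
      have c1 : ‖A x w (φ t)‖ ≤ M * ‖w‖ * B :=
        calc _ ≤ ‖A x‖ * ‖w‖ * ‖φ t‖ := ContinuousLinearMap.le_opNorm₂ _ _ _
          _ ≤ _ := by gcongr; exact hM x hx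
      have hK2 : 0 ≤ K * ‖w‖ ^ 2 := (norm_nonneg _).trans d2
      have b1 : ‖(A y - A x - t • DA x w) u (φ t)‖ ≤ K * ‖w‖ ^ 2 * r * B :=
        calc _ ≤ ‖A y - A x - t • DA x w‖ * ‖u‖ * ‖φ t‖ := ContinuousLinearMap.le_opNorm₂ _ _ _
          _ ≤ _ := by gcongr
      have b2 : ‖(A y - A x) w (φ t)‖ ≤ M₁ * ‖w‖ * ‖w‖ * B :=
        calc _ ≤ ‖A y - A x‖ * ‖w‖ * ‖φ t‖ := ContinuousLinearMap.le_opNorm₂ _ _ _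
          _ ≤ _ := by gcongr
      have b3 : ‖t • (A y - A x) u (A x w (φ t))‖ ≤ M₁ * ‖w‖ * r * (M * ‖w‖ * B) := by
        rw [norm_smul, Real.norm_eq_abs, abs_of_nonneg ht.1]
        refine (mul_le_of_le_one_left (norm_nonneg _) ht.2).trans ?_
        calc _ ≤ ‖A y - A x‖ * ‖u‖ * ‖A x w (φ t)‖ := ContinuousLinearMap.le_opNorm₂ _ _ _
          _ ≤ _ := by gcongr
      have b4 : ‖t • A y w (A x w (φ t))‖ ≤ M * ‖w‖ * (M * ‖w‖ * B) := by
        rw [norm_smul, Real.norm_eq_abs, abs_of_nonneg ht.1]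
        refine (mul_le_of_le_one_left (norm_nonneg _) ht.2).trans ?_
        calc _ ≤ ‖A y‖ * ‖w‖ * ‖A x w (φ t)‖ := ContinuousLinearMap.le_opNorm₂ _ _ _
          _ ≤ _ := by gcongr; exact hM y hy
      refine (norm_add_le _ _).trans (add_le_add b0 ?_)
      refine (norm_add₄_le).trans ?_
      calc _ ≤ _ := add_le_add (add_le_add (add_le_add b1 b2) b3) b4
        _ = _ := by ring
  have := key 1 (by simp)
  simp only [hP, one_smul, gronwallBound_of_K_ne_0 one_ne_zero] at this
  rw [sub_sub]
  refine this.trans (le_of_eq ?_)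
  simp
  ring

/-- **Frobenius theorem** for a flat linear total differential equation on a small ball. -/
theorem exists_hasFDerivAt_eq_apply [CompleteSpace V] {A : E → E →L[ℝ] V →L[ℝ] V}
    {DA : E → E →L[ℝ] E →L[ℝ] V →L[ℝ] V} {c : E} {r M M₁ K : ℝ} (hr : 0 < r)
    (hA : ∀ x ∈ ball c r, HasFDerivAt A (DA x) x)
    (hM : ∀ x ∈ ball c r, ‖A x‖ ≤ M) (hMr : M * r ≤ 1 / 2)
    (hM₁ : ∀ x ∈ ball c r, ‖DA x‖ ≤ M₁)
    (hK0 : 0 ≤ K) (hK : ∀ x ∈ ball c r, ∀ y ∈ ball c r, ‖DA y - DA x‖ ≤ K * ‖y - x‖)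
    (flat : ∀ x ∈ ball c r, ∀ u w v,
      DA x u w v + A x w (A x u v) = DA x w u v + A x u (A x w v)) (v : V) :
    ∃ F : E → V, F c = v ∧ ∀ x ∈ ball c r, HasFDerivAt F ((A x).flip (F x)) x := by
  have hAc : ContinuousOn A (ball c r) := fun x hx => (hA x hx).continuousAt.continuousWithinAt
  have hex : ∀ u : E, ∃ φ : ℝ → V, φ 0 = v ∧ (u ∈ ball (0 : E) r → ∀ t ∈ Icc (0 : ℝ) 1,
      HasDerivWithinAt φ (A (c + t • u) u (φ t)) (Icc 0 1) t) := by
    intro u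
    by_cases hu : u ∈ ball (0 : E) r
    · obtain ⟨φ, h0, h1⟩ := exists_ray_solution hAc hM hMr v hu
      exact ⟨φ, h0, fun _ => h1⟩
    · exact ⟨fun _ => v, rfl, fun h => absurd h hu⟩
  choose φ hφ0 hφ using hex
  have hmem : ∀ x ∈ ball c r, x - c ∈ ball (0 : E) r := fun x hx => by
    simpa [dist_eq_norm] using hx
  refine ⟨fun x => φ (x - c) 1, ?_, fun x hx => ?_⟩
  -- The ray from the centre to itself has zero velocity, so its equation is `φ' = 0`.
  · have h0 := hφ 0 (mem_ball_self hr)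
    have : ∀ t ∈ Icc (0 : ℝ) 1, φ 0 t - v = 0 := by
      refine eq_zero_of_abs_deriv_le_mul_abs_self_of_eq_zero_right (f' := fun _ => 0) (K := 0)
        (fun t ht => ((h0 t ht).sub_const v).continuousWithinAt) (fun t ht => ?_)
        (by simp [hφ0]) (fun t ht => by simp)
      have := ((h0 t (Ico_subset_Icc_self ht)).sub_const v).mono_of_mem_nhdsWithin
        (Icc_mem_nhdsGE_of_mem ht)
      simpa using this
    simpa [sub_eq_zero] using this 1 (by simp)
  · have hu := hmem x hx
    obtain ⟨B, hB⟩ := isCompact_Icc.exists_bound_of_continuousOn (f := φ (x - c))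
      (s := Icc (0 : ℝ) 1) (fun t ht => (hφ _ hu t ht).continuousWithinAt)
    -- The quadratic comparison of neighbouring rays is already differentiability with the right
    -- derivative; no theorem on smooth dependence of ODE solutions on parameters is needed.
    have hO : (fun y => φ (y - c) 1 - φ (x - c) 1 - A x (y - x) (φ (x - c) 1))
        =O[nhds x] fun y => ‖y - x‖ ^ 2 := by
      refine Asymptotics.IsBigO.of_bound
        ((K * r + M₁ + M₁ * r * M + M * M) * B * (Real.exp 1 - 1)) ?_
      filter_upwards [isOpen_ball.mem_nhds hx] with y hy
      have huw : (x - c) + (y - x) = y - c := by abel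
      have := norm_ray_solution_sub_le hA hM hMr hM₁ hK0 hK flat (u := x - c) (w := y - x)
        (φ := φ (x - c)) (ψ := φ (y - c)) hu (by rw [huw]; exact hmem y hy) hB
        (by rw [hφ0, hφ0]) (hφ _ hu) (by rw [huw]; exact hφ _ (hmem y hy))
      simpa using this
    have h1 : HasFDerivAt (fun y => φ (y - c) 1 - φ (x - c) 1 - A x (y - x) (φ (x - c) 1))
        (0 : E →L[ℝ] V) x := hO.hasFDerivAt (by norm_num)
    have h2 := (h1.add (((A x).flip (φ (x - c) 1)).hasFDerivAt (x := x))).const_add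
      (φ (x - c) 1 - A x x (φ (x - c) 1))
    rw [zero_add] at h2
    refine h2.congr_of_eventuallyEq (Filter.Eventually.of_forall fun y => ?_)
    simp only [map_sub, sub_apply, Pi.add_apply, ContinuousLinearMap.flip_apply]
    abel

/-- Bootstrap: if `F` is `Cⁿ`, so is the right-hand side of its equation, hence `F` is `Cⁿ⁺¹`. -/
theorem contDiffOn_of_hasFDerivAt_eq_apply {A : E → E →L[ℝ] V →L[ℝ] V} {F : E → V} {U : Set E}
    (hU : IsOpen U) (hA : ContDiffOn ℝ ∞ A U)
    (hF : ∀ x ∈ U, HasFDerivAt F ((A x).flip (F x)) x) : ContDiffOn ℝ ∞ F U := by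
  rw [contDiffOn_infty]
  intro n
  induction n with
  | zero =>
    exact contDiffOn_zero.2 fun x hx => (hF x hx).continuousAt.continuousWithinAt
  | succ n ih =>
    push_cast
    rw [contDiffOn_succ_iff_fderiv_of_isOpen hU]
    refine ⟨fun x hx => (hF x hx).differentiableAt.differentiableWithinAt, by simp, ?_⟩
    have h1 : ContDiffOn ℝ n (fun x => (A x).flip (F x)) U := by
      have h2 : ContDiffOn ℝ n (fun x => ContinuousLinearMap.flipₗᵢ ℝ E V V (A x)) U :=
        (ContinuousLinearMap.flipₗᵢ ℝ E V V).contDiff.comp_contDiffOn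
          (hA.of_le (by exact_mod_cast le_top))
      exact h2.clm_apply ih
    exact h1.congr fun x hx => (hF x hx).fderiv

/-- Local solvability of a flat smooth linear total differential equation. -/
theorem exists_ball_hasFDerivAt_eq_apply [CompleteSpace V] {A : E → E →L[ℝ] V →L[ℝ] V}
    {U : Set E} (hU : IsOpen U) (hA : ContDiffOn ℝ ∞ A U)
    (flat : ∀ x ∈ U, ∀ u w v, fderiv ℝ A x u w v + A x w (A x u v)
      = fderiv ℝ A x w u v + A x u (A x w v)) {c : E} (hc : c ∈ U) :
    ∃ r > 0, ball c r ⊆ U ∧ ∀ v : V, ∃ F : E → V, F c = v ∧ ContDiffOn ℝ ∞ F (ball c r) ∧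
      ∀ x ∈ ball c r, HasFDerivAt F ((A x).flip (F x)) x := by
  have hAc : ContDiffAt ℝ ∞ A c := hA.contDiffAt (hU.mem_nhds hc)
  have hDA : ContDiffAt ℝ 1 (fderiv ℝ A) c :=
    hAc.fderiv_right (m := 1) (by
      rw [one_add_one_eq_two]; exact WithTop.coe_le_coe.2 (le_top : (2 : ℕ∞) ≤ ⊤))
  obtain ⟨K, s, hs, hK⟩ := hDA.exists_lipschitzOnWith
  have h1 : ∀ᶠ x in nhds c, ‖A x‖ < ‖A c‖ + 1 :=
    hAc.continuousAt.norm.eventually_lt continuousAt_const (by simp)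
  have h2 : ∀ᶠ x in nhds c, ‖fderiv ℝ A x‖ < ‖fderiv ℝ A c‖ + 1 :=
    hDA.continuousAt.norm.eventually_lt continuousAt_const (by simp)
  obtain ⟨ε, hε, hball⟩ := Metric.eventually_nhds_iff_ball.1
    (((hU.eventually_mem hc).and (Filter.eventually_mem_set.2 hs)).and (h1.and h2))
  have hpos : 0 < ‖A c‖ + 1 := by positivity
  -- The second bound gives `M * r ≤ 1 / 2` for `M = ‖A c‖ + 1`. By linearity the radius does not
  -- depend on the initial value `v`.
  refine ⟨min ε (1 / (2 * (‖A c‖ + 1))), lt_min hε (by positivity), fun x hx =>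
    (hball x (ball_subset_ball (min_le_left _ _) hx)).1.1, fun v => ?_⟩
  set r := min ε (1 / (2 * (‖A c‖ + 1))) with hrdef
  have hb : ∀ x ∈ ball c r, _ := fun x hx => hball x (ball_subset_ball (min_le_left _ _) hx)
  have hMr : (‖A c‖ + 1) * r ≤ 1 / 2 := by
    calc _ ≤ (‖A c‖ + 1) * (1 / (2 * (‖A c‖ + 1))) := by gcongr; exact min_le_right _ _
      _ = _ := by field_simp
  obtain ⟨F, hFc, hF⟩ := exists_hasFDerivAt_eq_apply (A := A) (DA := fderiv ℝ A) (c := c) (r := r)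
    (M := ‖A c‖ + 1) (M₁ := ‖fderiv ℝ A c‖ + 1) (K := K) (lt_min hε (by positivity))
    (fun x hx => ((hA.contDiffAt (hU.mem_nhds (hb x hx).1.1)).differentiableAt
      (by simp)).hasFDerivAt) (fun x hx => (hb x hx).2.1.le) hMr
    (fun x hx => (hb x hx).2.2.le) K.2 (fun x hx y hy => by
      simpa [dist_eq_norm] using hK.dist_le_mul y (hb y hy).1.2 x (hb x hx).1.2)
    (fun x hx => flat x (hb x hx).1.1) v
  exact ⟨F, hFc, contDiffOn_of_hasFDerivAt_eq_apply isOpen_ball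
    (hA.mono fun x hx => (hb x hx).1.1) hF, hF⟩

end Frobenius

/-! ### Splitting of locally constant cocycles over a simply connected space. -/

section Cech

open Set Filter Topology

/-- With `Γ` discrete, the cocycle glues the products `U i × Γ` into a fibre bundle with discrete
fibre, that is, a covering. Over a simply connected base the covering has a global section, and its
expressions in the local trivialisations are the required `g i`. The transition maps act by right
multiplication with `c⁻¹`. -/
theorem exists_splitting_of_locallyConstant_cocycle {X ι Γ : Type*} [TopologicalSpace X]
    [SimplyConnectedSpace X] [LocallyPathConnectedSpace X] [Group Γ] {U : ι → Set X}
    (hU : ∀ i, IsOpen (U i)) (idx : X → ι) (hidx : ∀ x, x ∈ U (idx x)) (c : ι → ι → X → Γ)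
    (hc : ∀ i j, ∀ x ∈ U i ∩ U j, ∀ᶠ y in 𝓝 x, c i j y = c i j x)
    (hself : ∀ i, ∀ x ∈ U i, c i i x = 1)
    (hcomp : ∀ i j k, ∀ x ∈ U i ∩ U j ∩ U k, c j k x * c i j x = c i k x) :
    ∃ g : ι → X → Γ, (∀ i, ∀ x ∈ U i, ∀ᶠ y in 𝓝 x, g i y = g i x) ∧
      ∀ i j, ∀ x ∈ U i ∩ U j, g j x * c i j x = g i x := by
  let : TopologicalSpace Γ := ⊥
  have : DiscreteTopology Γ := ⟨rfl⟩
  let Z : FiberBundleCore ι X Γ :=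
    { baseSet := U
      isOpen_baseSet := hU
      indexAt := idx
      mem_baseSet_at := hidx
      coordChange := fun i j x v => v * (c i j x)⁻¹
      coordChange_self := fun i x hx v => by simp [hself i x hx]
      continuousOn_coordChange := fun i j => by
        rintro ⟨x, v⟩ ⟨hx, -⟩
        refine ContinuousAt.continuousWithinAt ?_
        have h1 : ContinuousAt (c i j) x :=
          continuousAt_const.congr ((hc i j x hx).mono fun y hy => hy.symm)
        have h2 : ContinuousAt (fun p : X × Γ => c i j p.1) (x, v) :=
          ContinuousAt.comp (g := c i j) (f := Prod.fst) h1 continuousAt_fst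
        exact continuousAt_snd.mul h2.inv
      coordChange_comp := fun i j k x hx v => by
        rw [← hcomp i j k x hx, mul_inv_rev, mul_assoc] }
  have hcov : IsCoveringMap (Bundle.TotalSpace.proj : Z.TotalSpace → X) :=
    FiberBundle.isCoveringMap (F := Γ) (E := Z.Fiber)
  obtain ⟨x₀⟩ : Nonempty X := inferInstance
  -- A global section is a lift of the identity map; the point over `x₀` may be chosen freely.
  obtain ⟨σ, ⟨-, hσ⟩, -⟩ := hcov.existsUnique_continuousMap_lifts (ContinuousMap.id X) x₀
    (⟨x₀, (1 : Γ)⟩ : Z.TotalSpace) rfl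
  have hσ' : ∀ x, (σ x).proj = x := fun x => congrFun hσ x
  refine ⟨fun i x => (Z.localTriv i (σ x)).2, fun i x hx => ?_, fun i j x hx => ?_⟩
  · have hmem : σ x ∈ (Z.localTriv i).source := by
      rw [FiberBundleCore.mem_localTriv_source, hσ' x]; exact hx
    have h1 : ContinuousAt (fun y => (Z.localTriv i (σ y)).2) x :=
      continuousAt_snd.comp (((Z.localTriv i).continuousAt hmem).comp σ.continuous.continuousAt)
    exact h1.eventually (mem_nhds_discrete.2 (mem_singleton _))
  · have h1 := Z.localTriv_apply (i := i) (p := σ x)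
    have h2 := Z.localTriv_apply (i := j) (p := σ x)
    have h3 := Z.coordChange_comp (Z.indexAt (σ x).proj) i j (σ x).proj
      ⟨⟨Z.mem_baseSet_at _, by rw [hσ']; exact hx.1⟩, by rw [hσ']; exact hx.2⟩ (σ x).2
    beta_reduce
    rw [h1, h2]
    dsimp only
    rw [← h3]
    have h4 : c i j (σ x).proj = c i j x := by rw [hσ']
    simp [Z, h4]

end Cech

/-! ### Calculus of partial derivatives in the plane. -/

noncomputable section PartialDerivatives

open Filter Topology

variable {V : Type*} [NormedAddCommGroup V] [NormedSpace ℝ V] {O : Set Plane} {u : Plane}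

/-- The partial derivative `∂f/∂uᵏ` of a vector-valued function. -/
def vpd (k : Fin 2) (f : Plane → V) (u : Plane) : V :=
  fderiv ℝ f u (EuclideanSpace.single k 1)

theorem pd_eq_vpd (k : Fin 2) (f : Plane → ℝ) (u : Plane) : pd k f u = vpd k f u := rfl

theorem fderiv_apply_eq_sum_vpd (f : Plane → V) (u w : Plane) :
    fderiv ℝ f u w = ∑ k, w k • vpd k f u := by
  conv_lhs => rw [← (EuclideanSpace.basisFun (Fin 2) ℝ).sum_repr w]
  simp [vpd]

theorem differentiableAt_of_contDiffOn {f : Plane → V} (hO : IsOpen O) (hf : ContDiffOn ℝ ∞ f O)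
    (hu : u ∈ O) : DifferentiableAt ℝ f u :=
  (hf.contDiffAt (hO.mem_nhds hu)).differentiableAt (by simp)

theorem contDiffOn_vpd {f : Plane → V} (hO : IsOpen O) (hf : ContDiffOn ℝ ∞ f O) (k : Fin 2) :
    ContDiffOn ℝ ∞ (vpd k f) O :=
  (hf.fderiv_of_isOpen hO (m := ∞) (by simp)).clm_apply contDiffOn_const

theorem contDiffOn_pd {f : Plane → ℝ} (hO : IsOpen O) (hf : ContDiffOn ℝ ∞ f O) (k : Fin 2) :
    ContDiffOn ℝ ∞ (pd k f) O :=
  contDiffOn_vpd hO hf k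

theorem vpd_congr {f f' : Plane → V} (hO : IsOpen O) (hu : u ∈ O) (h : ∀ w ∈ O, f w = f' w)
    (k : Fin 2) : vpd k f u = vpd k f' u := by
  have : f =ᶠ[𝓝 u] f' := by filter_upwards [hO.mem_nhds hu] with w hw using h w hw
  rw [vpd, this.fderiv_eq, vpd]

theorem pd_congr {f f' : Plane → ℝ} (hO : IsOpen O) (hu : u ∈ O) (h : ∀ w ∈ O, f w = f' w)
    (k : Fin 2) : pd k f u = pd k f' u :=
  vpd_congr hO hu h k

theorem vpd_comm {f : Plane → V} (hO : IsOpen O) (hf : ContDiffOn ℝ ∞ f O) (hu : u ∈ O)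
    (i j : Fin 2) : vpd i (vpd j f) u = vpd j (vpd i f) u := by
  have h1 : ContDiffAt ℝ ∞ f u := hf.contDiffAt (hO.mem_nhds hu)
  have h2 : DifferentiableAt ℝ (fderiv ℝ f) u :=
    differentiableAt_of_contDiffOn hO (hf.fderiv_of_isOpen hO (m := ∞) (by simp)) hu
  have h3 : ∀ a b : Fin 2, vpd a (vpd b f) u
      = fderiv ℝ (fderiv ℝ f) u (EuclideanSpace.single a 1) (EuclideanSpace.single b 1) := by
    intro a b
    have := fderiv_clm_apply (c := fderiv ℝ f)
      (u := fun _ : Plane => (EuclideanSpace.single b (1 : ℝ) : Plane)) h2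
      (differentiableAt_const _)
    change fderiv ℝ (fun w => fderiv ℝ f w (EuclideanSpace.single b 1)) u
      (EuclideanSpace.single a 1) = _
    rw [this]; simp
  rw [h3, h3]
  refine (h1.isSymmSndFDerivAt ?_).eq _ _
  simpa using WithTop.coe_le_coe.2 (le_top : (2 : ℕ∞) ≤ ⊤)

theorem pd_comm {f : Plane → ℝ} (hO : IsOpen O) (hf : ContDiffOn ℝ ∞ f O) (hu : u ∈ O)
    (i j : Fin 2) : pd i (pd j f) u = pd j (pd i f) u :=
  vpd_comm hO hf hu i j

theorem pd_add {f g : Plane → ℝ} (hf : DifferentiableAt ℝ f u) (hg : DifferentiableAt ℝ g u)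
    (k : Fin 2) : pd k (fun w => f w + g w) u = pd k f u + pd k g u := by
  simp only [pd]; rw [fderiv_fun_add hf hg]; rfl

theorem pd_sub {f g : Plane → ℝ} (hf : DifferentiableAt ℝ f u) (hg : DifferentiableAt ℝ g u)
    (k : Fin 2) : pd k (fun w => f w - g w) u = pd k f u - pd k g u := by
  simp only [pd]; rw [fderiv_fun_sub hf hg]; rfl

theorem pd_neg {f : Plane → ℝ} (k : Fin 2) : pd k (fun w => -f w) u = -pd k f u := by
  simp only [pd]; rw [fderiv_fun_neg]; rfl

theorem pd_mul {f g : Plane → ℝ} (hf : DifferentiableAt ℝ f u) (hg : DifferentiableAt ℝ g u)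
    (k : Fin 2) : pd k (fun w => f w * g w) u = f u * pd k g u + pd k f u * g u := by
  simp only [pd]; rw [fderiv_fun_mul hf hg]
  simp [mul_comm]

theorem pd_const (a : ℝ) (k : Fin 2) : pd k (fun _ => a) u = 0 := by
  simp [pd]

theorem vpd_smul {c : Plane → ℝ} {f : Plane → V} (hc : DifferentiableAt ℝ c u)
    (hf : DifferentiableAt ℝ f u) (k : Fin 2) :
    vpd k (fun w => c w • f w) u = c u • vpd k f u + pd k c u • f u := by
  simp only [pd, vpd]; rw [fderiv_fun_smul hc hf]; rfl

theorem vpd_sum {ι : Type*} (s : Finset ι) {f : ι → Plane → V}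
    (hf : ∀ i ∈ s, DifferentiableAt ℝ (f i) u) (k : Fin 2) :
    vpd k (fun w => ∑ i ∈ s, f i w) u = ∑ i ∈ s, vpd k (f i) u := by
  simp only [vpd]; rw [fderiv_fun_sum hf]; simp

end PartialDerivatives

/-! ### Levi-Civita connection and curvature tensor in coordinates. -/

noncomputable section CoordinateMetric

/-- A smooth field of symmetric matrices on `O`. -/
structure SmoothSymOn (H : Plane → Matrix (Fin 2) (Fin 2) ℝ) (O : Set Plane) : Prop where
  symm (u : Plane) (i j : Fin 2) : H u i j = H u j i
  contDiffOn (i j : Fin 2) : ContDiffOn ℝ ∞ (fun u => H u i j) O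

/-- The Christoffel symbols of the first kind. -/
def christoffelLow (G : Plane → Matrix (Fin 2) (Fin 2) ℝ) (m i j : Fin 2) (u : Plane) : ℝ :=
  (1 / 2) * (pd i (fun w => G w j m) u + pd j (fun w => G w i m) u - pd m (fun w => G w i j) u)

/-- The components `Hᵏᵢ = ∑ gᵏˡ Hₗᵢ`. -/
def raise (G H : Plane → Matrix (Fin 2) (Fin 2) ℝ) (k i : Fin 2) (u : Plane) : ℝ :=
  ∑ l, (G u)⁻¹ k l * H u l i

variable {G H : Plane → Matrix (Fin 2) (Fin 2) ℝ} {O : Set Plane} {u : Plane}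

/-- Identities involving the inverse metric are verified after lowering an index with this, so
entries of the inverse rarely have to be written out. -/
theorem sum_mul_inv_mul {A : Matrix (Fin 2) (Fin 2) ℝ} (hA : A.det ≠ 0) (m : Fin 2)
    (f : Fin 2 → ℝ) : ∑ l, A m l * ∑ k, A⁻¹ l k * f k = f m := by
  have : A.mulVec (A⁻¹.mulVec f) = f := by
    rw [Matrix.mulVec_mulVec, Matrix.mul_nonsing_inv _ (isUnit_iff_ne_zero.2 hA),
      Matrix.one_mulVec]
  exact congrFun this m

theorem eq_zero_of_sum_mul_eq_zero {A : Matrix (Fin 2) (Fin 2) ℝ} (hA : A.det ≠ 0)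
    {f : Fin 2 → ℝ} (h : ∀ m, ∑ l, A m l * f l = 0) (l : Fin 2) : f l = 0 :=
  congrFun (Matrix.eq_zero_of_mulVec_eq_zero hA (funext h)) l

theorem inv_fin_two (A : Matrix (Fin 2) (Fin 2) ℝ) :
    A⁻¹ = !![A.det⁻¹ * A 1 1, -(A.det⁻¹ * A 0 1); -(A.det⁻¹ * A 1 0), A.det⁻¹ * A 0 0] := by
  rw [Matrix.inv_def, Matrix.adjugate_fin_two, Ring.inverse_eq_inv']
  ext i j; fin_cases i <;> fin_cases j <;> simp

theorem contDiffOn_inv (hG : ∀ i j, ContDiffOn ℝ ∞ (fun u => G u i j) O)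
    (hdet : ∀ u ∈ O, (G u).det ≠ 0) (i j : Fin 2) :
    ContDiffOn ℝ ∞ (fun u => (G u)⁻¹ i j) O := by
  have hd : ContDiffOn ℝ ∞ (fun u => (G u).det⁻¹) O := by
    refine ContDiffOn.inv ?_ hdet
    simp only [Matrix.det_fin_two]
    exact ((hG 0 0).mul (hG 1 1)).sub ((hG 0 1).mul (hG 1 0))
  simp only [inv_fin_two]
  fin_cases i <;> fin_cases j <;> simp
  · exact hd.mul (hG 1 1)
  · exact (hd.mul (hG 0 1)).neg
  · exact (hd.mul (hG 1 0)).neg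
  · exact hd.mul (hG 0 0)

theorem christoffel_eq (k i j : Fin 2) (u : Plane) :
    christoffel G k i j u = ∑ l, (G u)⁻¹ k l * christoffelLow G l i j u := by
  simp only [christoffel, christoffelLow, Fin.sum_univ_two]; ring

theorem sum_mul_christoffel (hdet : (G u).det ≠ 0) (m i j : Fin 2) :
    ∑ l, G u m l * christoffel G l i j u = christoffelLow G m i j u := by
  simp only [christoffel_eq]
  exact sum_mul_inv_mul hdet m fun l => christoffelLow G l i j u

theorem sum_mul_raise (hdet : (G u).det ≠ 0) (m i : Fin 2) :
    ∑ l, G u m l * raise G H l i u = H u m i :=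
  sum_mul_inv_mul hdet m fun l => H u l i

theorem christoffelLow_symm (hG : ∀ u i j, G u i j = G u j i) (m i j : Fin 2) (u : Plane) :
    christoffelLow G m i j u = christoffelLow G m j i u := by
  have : (fun w => G w i j) = fun w => G w j i := funext fun w => hG w i j
  simp only [christoffelLow, this]; ring

theorem christoffel_symm (hG : ∀ u i j, G u i j = G u j i) (k i j : Fin 2) (u : Plane) :
    christoffel G k i j u = christoffel G k j i u := by
  simp only [christoffel_eq, christoffelLow_symm hG _ i j]

/-- Metric compatibility of the Levi-Civita connection, `∇g = 0`, in coordinates. -/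
theorem pd_metric (hG : ∀ u i j, G u i j = G u j i) (i j k : Fin 2) (u : Plane) :
    pd i (fun w => G w j k) u = christoffelLow G k i j u + christoffelLow G j i k u := by
  have h : ∀ a b, (fun w => G w a b) = fun w => G w b a := fun a b => funext fun w => hG w a b
  simp only [christoffelLow]
  rw [h k j, h i j, h i k]; ring

theorem contDiffOn_christoffelLow (hO : IsOpen O) (hG : SmoothSymOn G O) (m i j : Fin 2) :
    ContDiffOn ℝ ∞ (christoffelLow G m i j) O :=
  contDiffOn_const.mul (((contDiffOn_pd hO (hG.contDiffOn j m) i).add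
    (contDiffOn_pd hO (hG.contDiffOn i m) j)).sub (contDiffOn_pd hO (hG.contDiffOn i j) m))

theorem contDiffOn_christoffel (hO : IsOpen O) (hG : SmoothSymOn G O)
    (hdet : ∀ u ∈ O, (G u).det ≠ 0) (k i j : Fin 2) : ContDiffOn ℝ ∞ (christoffel G k i j) O := by
  have : christoffel G k i j = fun u => ∑ l, (G u)⁻¹ k l * christoffelLow G l i j u :=
    funext fun u => christoffel_eq k i j u
  rw [this]
  exact ContDiffOn.sum fun l _ =>
    (contDiffOn_inv hG.contDiffOn hdet k l).mul (contDiffOn_christoffelLow hO hG l i j)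

theorem contDiffOn_raise (hG : SmoothSymOn G O) (hH : SmoothSymOn H O)
    (hdet : ∀ u ∈ O, (G u).det ≠ 0) (k i : Fin 2) : ContDiffOn ℝ ∞ (raise G H k i) O :=
  ContDiffOn.sum fun l _ => (contDiffOn_inv hG.contDiffOn hdet k l).mul (hH.contDiffOn l i)

/-- Differentiation of a relation `∑ gₘₗ fˡ = fₘ`. -/
theorem sum_mul_pd (hO : IsOpen O) (hG : SmoothSymOn G O) {f f' : Fin 2 → Plane → ℝ}
    (hf : ∀ l, ContDiffOn ℝ ∞ (f l) O) (h : ∀ u ∈ O, ∀ m, ∑ l, G u m l * f l u = f' m u)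
    (hu : u ∈ O) (k m : Fin 2) :
    ∑ l, G u m l * pd k (f l) u
      = pd k (f' m) u - ∑ l, pd k (fun w => G w m l) u * f l u := by
  have d1 : ∀ l, DifferentiableAt ℝ (fun w => G w m l) u := fun l =>
    differentiableAt_of_contDiffOn hO (hG.contDiffOn m l) hu
  have d2 : ∀ l, DifferentiableAt ℝ (f l) u := fun l => differentiableAt_of_contDiffOn hO (hf l) hu
  have := pd_congr hO hu (fun w hw => h w hw m) k
  simp only [Fin.sum_univ_two] at this
  rw [pd_add (f := fun w => G w m 0 * f 0 w) (g := fun w => G w m 1 * f 1 w)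
    ((d1 0).mul (d2 0)) ((d1 1).mul (d2 1)), pd_mul (d1 0) (d2 0),
    pd_mul (d1 1) (d2 1)] at this
  simp only [Fin.sum_univ_two]
  linear_combination this

theorem pd_christoffelLow_add (hO : IsOpen O) (hG : SmoothSymOn G O) (hu : u ∈ O)
    (l i j k : Fin 2) :
    pd l (christoffelLow G k i j) u + pd l (christoffelLow G j i k) u
      = pd l (pd i fun w => G w j k) u := by
  have h : (pd i fun w => G w j k)
      = fun w => christoffelLow G k i j w + christoffelLow G j i k w :=
    funext fun w => pd_metric hG.symm i j k w
  rw [h, pd_add (differentiableAt_of_contDiffOn hO (contDiffOn_christoffelLow hO hG k i j) hu)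
    (differentiableAt_of_contDiffOn hO (contDiffOn_christoffelLow hO hG j i k) hu)]

/-- The curvature tensor with lowered index. -/
theorem sum_mul_riemannTensor (hO : IsOpen O) (hG : SmoothSymOn G O)
    (hdet : ∀ u ∈ O, (G u).det ≠ 0) (hu : u ∈ O) (m k i j : Fin 2) :
    ∑ l, G u m l * riemannTensor G l k i j u
      = pd i (christoffelLow G m j k) u - pd j (christoffelLow G m i k) u
        - ∑ l, christoffelLow G l i m u * christoffel G l j k u
        + ∑ l, christoffelLow G l j m u * christoffel G l i k u := by
  have h1 : ∀ a b, ∑ l, G u m l * pd a (christoffel G l b k) u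
      = pd a (christoffelLow G m b k) u
        - ∑ l, pd a (fun w => G w m l) u * christoffel G l b k u := fun a b =>
    sum_mul_pd hO hG (f := fun l => christoffel G l b k) (f' := fun m => christoffelLow G m b k)
      (fun l => contDiffOn_christoffel hO hG hdet l b k)
      (fun w hw m => sum_mul_christoffel (hdet w hw) m b k) hu a m
  have h2 := h1 i j
  have h3 := h1 j i
  have h4 := fun a b => sum_mul_christoffel (hdet u hu) m a b
  have p := fun a l => pd_metric hG.symm a m l u
  simp only [Fin.sum_univ_two, riemannTensor, p] at h2 h3 h4 ⊢
  -- The summand `Γ_{m a l}` of `∂ₐ g_{ml}` cancels the quadratic terms of `riemannTensor`; the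
  -- summand `Γ_{l a m}` survives.
  linear_combination h2 - h3 + christoffel G 0 j k u * h4 i 0 + christoffel G 1 j k u * h4 i 1
    - christoffel G 0 i k u * h4 j 0 - christoffel G 1 i k u * h4 j 1

/-- In the part symmetric in `m` and `k`, the derivative terms add up to the commutator of `∂ᵢ` and
`∂ⱼ` on `g_{km}`, and the quadratic terms cancel by symmetry of the metric. -/
theorem sum_mul_riemannTensor_antisymm (hO : IsOpen O) (hG : SmoothSymOn G O)
    (hdet : ∀ u ∈ O, (G u).det ≠ 0) (hu : u ∈ O) (m k i j : Fin 2) :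
    ∑ l, G u m l * riemannTensor G l k i j u = -∑ l, G u k l * riemannTensor G l m i j u := by
  have e1 := pd_christoffelLow_add hO hG hu i j k m
  have e2 := pd_christoffelLow_add hO hG hu j i k m
  have e3 := pd_comm hO (hG.contDiffOn k m) hu i j
  have s := fun l a b => sum_mul_christoffel (hdet u hu) l a b
  rw [sum_mul_riemannTensor hO hG hdet hu, sum_mul_riemannTensor hO hG hdet hu]
  simp only [← s, Fin.sum_univ_two]
  have hs := hG.symm u 0 1
  linear_combination e1 - e2 + e3 - (christoffel G 1 i m u * christoffel G 0 j k u
    + christoffel G 1 i k u * christoffel G 0 j m u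
    - christoffel G 0 i m u * christoffel G 1 j k u
    - christoffel G 0 i k u * christoffel G 1 j m u) * hs

end CoordinateMetric

/-! ### The connection form of the frame and its curvature. -/

noncomputable section StructureEquations

variable {G H : Plane → Matrix (Fin 2) (Fin 2) ℝ} {O : Set Plane} {u : Plane}

/-- The matrix `Aᵢ` of the structure equations `∂ᵢ F = Aᵢ F` for the frame `F = (x, ∂₀x, ∂₁x, y)`
of a surface with metric `G` and second fundamental form `H`. -/
def connForm (G H : Plane → Matrix (Fin 2) (Fin 2) ℝ) (i : Fin 2) (u : Plane) :
    Matrix (Fin 4) (Fin 4) ℝ :=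
  !![0, if i = 0 then 1 else 0, if i = 1 then 1 else 0, 0;
    H u i 0, christoffel G 0 i 0 u, christoffel G 1 i 0 u, -G u i 0;
    H u i 1, christoffel G 0 i 1 u, christoffel G 1 i 1 u, -G u i 1;
    0, -raise G H 0 i u, -raise G H 1 i u, 0]

/-- The curvature of the connection form. -/
def connCurv (G H : Plane → Matrix (Fin 2) (Fin 2) ℝ) (a b : Fin 4) (u : Plane) : ℝ :=
  pd 0 (fun w => connForm G H 1 w a b) u + ∑ c, connForm G H 1 u a c * connForm G H 0 u c b
    - pd 1 (fun w => connForm G H 0 w a b) u - ∑ c, connForm G H 0 u a c * connForm G H 1 u c b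

/-- The Gram matrix of the frame `(x, ∂₀x, ∂₁x, y)`. -/
def gramForm (G : Plane → Matrix (Fin 2) (Fin 2) ℝ) (u : Plane) : Matrix (Fin 4) (Fin 4) ℝ :=
  !![0, 0, 0, 1;
    0, G u 0 0, G u 0 1, 0;
    0, G u 1 0, G u 1 1, 0;
    1, 0, 0, 0]

theorem contDiffOn_connForm (hO : IsOpen O) (hG : SmoothSymOn G O) (hH : SmoothSymOn H O)
    (hdet : ∀ u ∈ O, (G u).det ≠ 0) (i : Fin 2) (a b : Fin 4) :
    ContDiffOn ℝ ∞ (fun u => connForm G H i u a b) O := by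
  have h1 := fun k j => contDiffOn_christoffel hO hG hdet k i j
  have h2 := fun k => contDiffOn_raise hG hH hdet k i
  fin_cases a <;> fin_cases b <;> first
    | exact contDiffOn_const
    | exact hH.contDiffOn _ _
    | exact h1 _ _
    | exact (h2 _).neg
    | exact (hG.contDiffOn _ _).neg

theorem contDiffOn_gramForm (hG : SmoothSymOn G O) (a b : Fin 4) :
    ContDiffOn ℝ ∞ (fun u => gramForm G u a b) O := by
  fin_cases a <;> fin_cases b <;> first
    | exact contDiffOn_const
    | exact hG.contDiffOn _ _

/-- The index of `∂ₖx` in the frame `(x, ∂₀x, ∂₁x, y)`. -/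
def tanIdx (k : Fin 2) : Fin 4 := if k = 0 then 1 else 2

/-- The connection preserves the prescribed Gram form: `∂S = AS + SAᵀ`. Consequently the Gram matrix
of any solution frame obeys the same linear system as `S`. -/
theorem pd_gramForm (hG : SmoothSymOn G O) (hH : SmoothSymOn H O) (hdet : (G u).det ≠ 0)
    (i : Fin 2) (a b : Fin 4) :
    pd i (fun w => gramForm G w a b) u = ∑ c, connForm G H i u a c * gramForm G u c b
      + ∑ c, connForm G H i u b c * gramForm G u a c := by
  have p := fun j k => pd_metric hG.symm i j k u
  have s := fun m j => sum_mul_christoffel hdet m i j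
  have r := fun m => sum_mul_raise (H := H) hdet m i
  have hs := hG.symm u 1 0
  have hh := hH.symm u
  have c0 : ∀ a : ℝ, pd i (fun _ => a) u = 0 := fun a => pd_const a i
  simp only [Fin.sum_univ_two] at s r
  fin_cases a <;> fin_cases b <;>
    simp [gramForm, connForm, Fin.sum_univ_four, c0, p]
  all_goals
    have s00 := s 0 0
    have s01 := s 0 1
    have s10 := s 1 0
    have s11 := s 1 1
    have r0 := r 0
    have r1 := r 1
    fin_cases i <;> simp [hs, hh 1 0] at s00 s01 s10 s11 r0 r1 ⊢ <;> linarith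

theorem connCurv_tanIdx_zero (k : Fin 2) (u : Plane) :
    connCurv G H (tanIdx k) 0 u = pd 0 (fun w => H w 1 k) u - pd 1 (fun w => H w 0 k) u
      + ∑ m, christoffel G m 1 k u * H u 0 m - ∑ m, christoffel G m 0 k u * H u 1 m := by
  fin_cases k <;> simp [connCurv, connForm, tanIdx, Fin.sum_univ_four] <;> ring

theorem connCurv_tanIdx_tanIdx (k l : Fin 2) (u : Plane) :
    connCurv G H (tanIdx k) (tanIdx l) u = riemannTensor G l k 0 1 u
      + (if l = 0 then H u 1 k else 0) - (if l = 1 then H u 0 k else 0)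
      + G u 1 k * raise G H l 0 u - G u 0 k * raise G H l 1 u := by
  fin_cases k <;> fin_cases l <;>
    simp [connCurv, connForm, tanIdx, Fin.sum_univ_four, riemannTensor] <;> ring

theorem connCurv_three_tanIdx (l : Fin 2) (u : Plane) :
    connCurv G H 3 (tanIdx l) u = -pd 0 (raise G H l 1) u + pd 1 (raise G H l 0) u
      - ∑ m, raise G H m 1 u * christoffel G l 0 m u
      + ∑ m, raise G H m 0 u * christoffel G l 1 m u := by
  have h := fun i j => pd_neg (u := u) (f := raise G H l i) j
  fin_cases l <;> simp at h <;>
    simp [connCurv, connForm, tanIdx, Fin.sum_univ_four, h] <;> ring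

/-- No condition on the surface arises here: metric compatibility and torsion-freeness suffice. -/
theorem connCurv_tanIdx_three (hG : SmoothSymOn G O) (hdet : (G u).det ≠ 0) (k : Fin 2) :
    connCurv G H (tanIdx k) 3 u = 0 := by
  have p := fun i j => pd_metric hG.symm i j k u
  have n := fun i j l => pd_neg (u := u) (f := fun w => G w j l) i
  have s := fun m i j => sum_mul_christoffel hdet m i j
  have t := fun m => christoffelLow_symm hG.symm m 0 1 u
  simp only [Fin.sum_univ_two] at s
  have s1 := s 0 1 k
  have s2 := s 1 0 k
  have t1 := t k
  fin_cases k <;> simp at p s1 s2 t1 <;>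
    simp [connCurv, connForm, tanIdx, Fin.sum_univ_four, n, p] <;> linarith

theorem connCurv_zero (hG : SmoothSymOn G O) (hH : SmoothSymOn H O) (b : Fin 4) (u : Plane) :
    connCurv G H 0 b u = 0 := by
  have hs := hG.symm u 1 0
  have hh := hH.symm u 1 0
  have t := fun m => christoffel_symm hG.symm m 0 1 u
  have c0 : ∀ (i : Fin 2) (a : ℝ), pd i (fun _ => a) u = 0 := fun i a => pd_const a i
  fin_cases b <;> simp [connCurv, connForm, Fin.sum_univ_four, c0, t, hs, hh]

theorem connCurv_three_zero (hG : SmoothSymOn G O) (hH : SmoothSymOn H O) (u : Plane) :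
    connCurv G H 3 0 u = 0 := by
  have hs := hG.symm u 1 0
  have hh := hH.symm u 1 0
  have c0 : ∀ (i : Fin 2) (a : ℝ), pd i (fun _ => a) u = 0 := fun i a => pd_const a i
  simp [connCurv, connForm, Fin.sum_univ_four, c0, raise, inv_fin_two, hs, hh]
  ring

theorem connCurv_three_three (hG : SmoothSymOn G O) (hH : SmoothSymOn H O)
    (hdet : (G u).det ≠ 0) : connCurv G H 3 3 u = 0 := by
  have hs := hG.symm u 1 0
  have hh := hH.symm u 1 0
  have c0 : ∀ (i : Fin 2) (a : ℝ), pd i (fun _ => a) u = 0 := fun i a => pd_const a i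
  have r := fun m i => sum_mul_raise (H := H) hdet m i
  simp only [Fin.sum_univ_two] at r
  have r1 := r 0 1
  have r2 := r 1 0
  simp [connCurv, connForm, Fin.sum_univ_four, c0, hs, hh] at r1 r2 ⊢
  linarith

/-- The Codazzi part of the curvature with raised index. -/
theorem sum_mul_connCurv_three (hO : IsOpen O) (hG : SmoothSymOn G O) (hH : SmoothSymOn H O)
    (hdet : ∀ u ∈ O, (G u).det ≠ 0) (hu : u ∈ O) (m : Fin 2) :
    ∑ l, G u m l * connCurv G H 3 (tanIdx l) u = -connCurv G H (tanIdx m) 0 u := by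
  have h1 := fun k i => sum_mul_pd hO hG (f := fun l => raise G H l i) (f' := fun m u => H u m i)
    (fun l => contDiffOn_raise hG hH hdet l i)
    (fun w hw m => sum_mul_raise (hdet w hw) m i) hu k m
  have e1 := h1 0 1
  have e2 := h1 1 0
  have p := fun a l => pd_metric hG.symm a m l u
  have s := fun l a b => sum_mul_christoffel (hdet u hu) l a b
  have r := fun i j => sum_mul_raise (H := H) (hdet u hu) i j
  have hs := hG.symm u 1 0
  have hh : (fun w => H w m 1) = fun w => H w 1 m := funext fun w => hH.symm w m 1
  have hh' : (fun w => H w m 0) = fun w => H w 0 m := funext fun w => hH.symm w m 0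
  have h10 := hH.symm u 1 0
  simp only [connCurv_three_tanIdx, connCurv_tanIdx_zero, Fin.sum_univ_two] at e1 e2 s r ⊢
  simp only [p, hh, hh'] at e1 e2
  have q1 := s m 0 0
  have q2 := s m 0 1
  have q3 := s m 1 0
  have q4 := s m 1 1
  have w1 := s 0 0 m
  have w2 := s 1 0 m
  have w3 := s 0 1 m
  have w4 := s 1 1 m
  linear_combination -e1 + e2 - raise G H 0 1 u * q1 - raise G H 1 1 u * q2
    + raise G H 0 0 u * q3 + raise G H 1 0 u * q4 - raise G H 0 1 u * w1 - raise G H 1 1 u * w2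
    + raise G H 0 0 u * w3 + raise G H 1 0 u * w4
    + christoffel G 0 0 m u * r 0 1 + christoffel G 1 0 m u * r 1 1
    - christoffel G 0 1 m u * r 0 0 - christoffel G 1 1 m u * r 1 0
    + christoffel G 0 0 m u * hH.symm u 0 1 + christoffel G 1 1 m u * hH.symm u 0 1
    + (raise G H 1 1 u * christoffel G 0 0 m u - raise G H 0 1 u * christoffel G 1 0 m u
      + raise G H 0 0 u * christoffel G 1 1 m u - raise G H 1 0 u * christoffel G 0 1 m u) * hs

/-- The terms with `Γᵐ₀₁` and `Γᵐ₁₀` cancel because the connection is torsion-free, leaving the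
Codazzi component of the curvature. -/
theorem covDerivTensor_sub_eq_connCurv (hG : SmoothSymOn G O) (j : Fin 2) (u : Plane) :
    covDerivTensor G H 0 1 j u - covDerivTensor G H 1 0 j u = connCurv G H (tanIdx j) 0 u := by
  have t := fun m => christoffel_symm hG.symm m 0 1 u
  simp only [connCurv_tanIdx_zero, covDerivTensor, Fin.sum_univ_two, t]
  ring

theorem covDerivTensor_symm (hH : SmoothSymOn H O) (k i j : Fin 2) (u : Plane) :
    covDerivTensor G H k i j u = covDerivTensor G H k j i u := by
  have h : (fun w => H w i j) = fun w => H w j i := funext fun w => hH.symm w i j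
  simp only [covDerivTensor, h, hH.symm u _ j, hH.symm u i]
  ring

theorem trace_inv_mul_eq (hG : SmoothSymOn G O) (hH : SmoothSymOn H O) (u : Plane) :
    ((G u)⁻¹ * H u).trace
      = (G u 0 0 * H u 1 1 + G u 1 1 * H u 0 0 - 2 * G u 0 1 * H u 0 1) / (G u).det := by
  have hs := hG.symm u 1 0
  have hh := hH.symm u 1 0
  rw [Matrix.trace_fin_two, Matrix.mul_apply, Matrix.mul_apply, inv_fin_two]
  simp [Fin.sum_univ_two, hs, hh]
  ring

/-- With the index lowered, the tangential block is the Riemann tensor plus a Kulkarni-Nomizu type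
product of `G` and `H`. This form makes its antisymmetry visible. -/
theorem sum_mul_connCurv_tanIdx (hH : SmoothSymOn H O) (hdet : (G u).det ≠ 0)
    (m k : Fin 2) : ∑ l, G u m l * connCurv G H (tanIdx k) (tanIdx l) u
      = ∑ l, G u m l * riemannTensor G l k 0 1 u + G u m 0 * H u 1 k - G u m 1 * H u 0 k
        + G u 1 k * H u 0 m - G u 0 k * H u 1 m := by
  have r := fun i => sum_mul_raise (H := H) hdet m i
  simp only [connCurv_tanIdx_tanIdx, Fin.sum_univ_two] at r ⊢
  have r0 := r 0
  have r1 := r 1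
  have h0 := hH.symm u m 0
  have h1 := hH.symm u m 1
  simp
  linear_combination G u 1 k * r0 - G u 0 k * r1 + G u 1 k * h0 - G u 0 k * h1

/-- The Gauss equation is the essential tangential component of the curvature of the connection. -/
theorem gaussCoord_add_trace (hG : SmoothSymOn G O) (hH : SmoothSymOn H O) (hdet : (G u).det ≠ 0) :
    gaussCoord G u + ((G u)⁻¹ * H u).trace
      = (∑ l, G u 0 l * connCurv G H 2 (tanIdx l) u) / (G u).det := by
  have h := sum_mul_connCurv_tanIdx hH hdet 0 1
  have h2 : tanIdx 1 = 2 := rfl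
  rw [h2] at h
  rw [h, trace_inv_mul_eq hG hH, gaussCoord, ← add_div, hH.symm u 1 0]
  congr 1; ring

/-- The Gauss and Codazzi equations make the connection flat. -/
theorem connCurv_eq_zero (hO : IsOpen O) (hG : SmoothSymOn G O) (hH : SmoothSymOn H O)
    (hdet : ∀ u ∈ O, (G u).det ≠ 0)
    (hcod : ∀ u ∈ O, ∀ j, covDerivTensor G H 0 1 j u = covDerivTensor G H 1 0 j u)
    (hgauss : ∀ u ∈ O, gaussCoord G u = -((G u)⁻¹ * H u).trace) (hu : u ∈ O) (a b : Fin 4) :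
    connCurv G H a b u = 0 := by
  have hc : ∀ j, connCurv G H (tanIdx j) 0 u = 0 := fun j => by
    rw [← covDerivTensor_sub_eq_connCurv (H := H) hG, hcod u hu, sub_self]
  -- The lowered tangential block is antisymmetric in `(m, k)`, hence determined by one off-diagonal
  -- entry, and that entry vanishes by `K + trace = 0`.
  have hB : ∀ k m, ∑ l, G u m l * connCurv G H (tanIdx k) (tanIdx l) u = 0 := by
    have h1 := fun m k => sum_mul_connCurv_tanIdx hH (hdet u hu) m k
    have h2 := fun m k => sum_mul_riemannTensor_antisymm hO hG hdet hu m k 0 1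
    have h3 := gaussCoord_add_trace hG hH (hdet u hu)
    rw [hgauss u hu, neg_add_cancel, eq_comm, div_eq_zero_iff, or_iff_left (hdet u hu)] at h3
    have hs := hG.symm u 1 0
    have hh := hH.symm u 1 0
    have h4 : ∀ m k, ∑ l, G u m l * connCurv G H (tanIdx k) (tanIdx l) u
        = -∑ l, G u k l * connCurv G H (tanIdx m) (tanIdx l) u := by
      intro m k
      rw [h1, h1, h2]
      have q1 := hG.symm u 0 m
      have q2 := hG.symm u 1 m
      have q3 := hG.symm u 0 k
      have q4 := hG.symm u 1 k
      rw [q1, q2, q3, q4]; ring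
    intro k m
    fin_cases k <;> fin_cases m
    · have := h4 0 0; simp only [Fin.zero_eta] at this ⊢; linarith
    · have := h4 1 0
      simp only [Fin.zero_eta, Fin.mk_one] at this ⊢
      rw [this]; exact neg_eq_zero.2 h3
    · exact h3
    · have := h4 1 1; simp only [Fin.mk_one] at this ⊢; linarith
  have htt := fun k => eq_zero_of_sum_mul_eq_zero (hdet u hu) (hB k)
  have h3 := eq_zero_of_sum_mul_eq_zero (hdet u hu) (f := fun l => connCurv G H 3 (tanIdx l) u)
    fun m => by rw [sum_mul_connCurv_three hO hG hH hdet hu, hc, neg_zero]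
  have ht3 := fun k => connCurv_tanIdx_three (H := H) hG (hdet u hu) k
  fin_cases a
  · exact connCurv_zero hG hH b u
  · fin_cases b
    exacts [hc 0, htt 0 0, htt 0 1, ht3 0]
  · fin_cases b
    exacts [hc 1, htt 1 0, htt 1 1, ht3 1]
  · fin_cases b
    exacts [connCurv_three_zero hG hH u, h3 0, h3 1, connCurv_three_three hG hH (hdet u hu)]

end StructureEquations

/-! ### Linear systems `∂ᵢF = AᵢF` on planar domains: local uniqueness and existence. -/

noncomputable section LinearSystems

open Filter Topology

set_option maxSynthPendingDepth 3

theorem vpd_pi {ι W : Type*} [Fintype ι] [NormedAddCommGroup W] [NormedSpace ℝ W] {u : Plane}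
    {F : Plane → ι → W} {F' : Plane →L[ℝ] (ι → W)} (h : HasFDerivAt F F' u)
    (i : Fin 2) (a : ι) : vpd i (fun w => F w a) u = F' (EuclideanSpace.single i 1) a := by
  have := (hasFDerivAt_pi'.1 h) a
  rw [vpd, this.fderiv]; rfl

variable {ι W : Type*} [Fintype ι] [DecidableEq ι] [NormedAddCommGroup W] [NormedSpace ℝ W]
  {O : Set Plane} {u : Plane}

/-- The operator-valued one-form `∑ Aᵢ duⁱ` given by two matrix-valued functions `A₀`, `A₁`. -/
def totalForm (W : Type*) [NormedAddCommGroup W] [NormedSpace ℝ W]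
    (m : Fin 2 → Plane → Matrix ι ι ℝ) (u : Plane) :
    Plane →L[ℝ] (ι → W) →L[ℝ] (ι → W) :=
  ∑ i, ∑ a, ∑ b, m i u a b • (EuclideanSpace.proj i : Plane →L[ℝ] ℝ).smulRight
    ((ContinuousLinearMap.single ℝ (fun _ : ι => W) a).comp (ContinuousLinearMap.proj b))

theorem totalForm_apply (m : Fin 2 → Plane → Matrix ι ι ℝ) (u w : Plane) (v : ι → W) (a : ι) :
    totalForm W m u w v a = ∑ i, w i • ∑ b, m i u a b • v b := by
  simp only [totalForm, sum_apply, smul_apply,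
    ContinuousLinearMap.smulRight_apply, PiLp.proj_apply, Finset.sum_apply,
    Pi.smul_apply, ContinuousLinearMap.comp_apply, ContinuousLinearMap.proj_apply,
    ContinuousLinearMap.single_apply]
  refine Finset.sum_congr rfl fun i _ => ?_
  rw [Finset.sum_eq_single a]
  · simp only [Pi.single_eq_same, Finset.smul_sum]
    exact Finset.sum_congr rfl fun b _ => smul_comm _ _ _
  · intro a' _ ha'
    simp [Pi.single_eq_of_ne (Ne.symm ha')]
  · simp

theorem contDiffOn_totalForm {m : Fin 2 → Plane → Matrix ι ι ℝ}
    (hm : ∀ i a b, ContDiffOn ℝ ∞ (fun u => m i u a b) O) : ContDiffOn ℝ ∞ (totalForm W m) O := by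
  unfold totalForm
  exact ContDiffOn.sum fun i _ => ContDiffOn.sum fun a _ => ContDiffOn.sum fun b _ =>
    (hm i a b).smul contDiffOn_const

theorem fderiv_totalForm_apply (hO : IsOpen O) {m : Fin 2 → Plane → Matrix ι ι ℝ}
    (hm : ∀ i a b, ContDiffOn ℝ ∞ (fun u => m i u a b) O) (hu : u ∈ O) (w w' : Plane) (v : ι → W)
    (a : ι) : fderiv ℝ (totalForm W m) u w w' v a
      = ∑ i, w' i • ∑ b, (∑ k, w k * pd k (fun x => m i x a b) u) • v b := by
  have hd : ∀ i a b, DifferentiableAt ℝ (fun u => m i u a b) u := fun i a b =>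
    differentiableAt_of_contDiffOn hO (hm i a b) hu
  have h : HasFDerivAt (totalForm W m) (∑ i, ∑ a, ∑ b,
      (fderiv ℝ (fun u => m i u a b) u).smulRight
        ((EuclideanSpace.proj i : Plane →L[ℝ] ℝ).smulRight
          ((ContinuousLinearMap.single ℝ (fun _ : ι => W) a).comp
            (ContinuousLinearMap.proj (R := ℝ) (φ := fun _ : ι => W) b)))) u := by
    unfold totalForm
    exact HasFDerivAt.fun_sum fun i _ => HasFDerivAt.fun_sum fun a _ => HasFDerivAt.fun_sum
      fun b _ => (hd i a b).hasFDerivAt.smul_const _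
  have h2 : fderiv ℝ (totalForm W m) u w = totalForm W
      (fun i x => Matrix.of fun a b => fderiv ℝ (fun u => m i u a b) u w) u := by
    rw [h.fderiv]
    simp [totalForm]
  rw [h2, totalForm_apply]
  refine Finset.sum_congr rfl fun i _ => ?_
  congr 1
  refine Finset.sum_congr rfl fun b _ => ?_
  congr 1
  rw [Matrix.of_apply, fderiv_apply_eq_sum_vpd]
  rfl

theorem hasFDerivAt_totalForm {m : Fin 2 → Plane → Matrix ι ι ℝ} {F : Plane → ι → W}
    (hd : ∀ a, DifferentiableAt ℝ (fun w => F w a) u)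
    (h : ∀ i a, vpd i (fun w => F w a) u = ∑ b, m i u a b • F u b) :
    HasFDerivAt F ((totalForm W m u).flip (F u)) u := by
  rw [hasFDerivAt_pi']
  intro a
  refine (hd a).hasFDerivAt.congr_fderiv ?_
  ext w
  rw [fderiv_apply_eq_sum_vpd]
  simp only [h, ContinuousLinearMap.comp_apply, ContinuousLinearMap.proj_apply,
    ContinuousLinearMap.flip_apply, totalForm_apply]

/-- Local uniqueness for linear total differential systems. -/
theorem eventually_eq_zero_of_linearSystem (hO : IsOpen O) {m : Fin 2 → Plane → Matrix ι ι ℝ}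
    (hm : ∀ i a b, ContDiffOn ℝ ∞ (fun u => m i u a b) O) {F : Plane → ι → W}
    (hd : ∀ w ∈ O, ∀ a, DifferentiableAt ℝ (fun w => F w a) w)
    (h : ∀ w ∈ O, ∀ i a, vpd i (fun w => F w a) w = ∑ b, m i w a b • F w b)
    (hu : u ∈ O) (h0 : F u = 0) : ∀ᶠ w in 𝓝 u, F w = 0 := by
  have hc : ContinuousAt (totalForm W m) u :=
    ((contDiffOn_totalForm hm).contDiffAt (hO.mem_nhds hu)).continuousAt
  have h1 : ∀ᶠ w in 𝓝 u, ‖totalForm W m w‖ < ‖totalForm W m u‖ + 1 :=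
    hc.norm.eventually_lt continuousAt_const (by simp)
  obtain ⟨r, hr, hball⟩ := Metric.eventually_nhds_iff_ball.1 ((hO.eventually_mem hu).and h1)
  filter_upwards [Metric.ball_mem_nhds u hr] with w hw
  refine eq_zero_of_norm_fderiv_le_mul_norm (K := ‖totalForm W m u‖ + 1)
    (fun x hx => hasFDerivAt_totalForm (m := m) (hd x (hball x hx).1) (h x (hball x hx).1))
    (fun x hx => ?_) h0 hw
  calc _ ≤ ‖(totalForm W m x).flip‖ * ‖F x‖ := ContinuousLinearMap.le_opNorm _ _
    _ ≤ _ := by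
      rw [ContinuousLinearMap.opNorm_flip]
      gcongr
      exact (hball x hx).2.le

/-- Local existence for flat linear total differential systems. -/
theorem exists_solution_linearSystem [CompleteSpace W] (hO : IsOpen O)
    {m : Fin 2 → Plane → Matrix ι ι ℝ} (hm : ∀ i a b, ContDiffOn ℝ ∞ (fun u => m i u a b) O)
    (flat : ∀ w ∈ O, ∀ a b, pd 0 (fun x => m 1 x a b) w + ∑ c, m 1 w a c * m 0 w c b
      - pd 1 (fun x => m 0 x a b) w - ∑ c, m 0 w a c * m 1 w c b = 0)
    (hu : u ∈ O) (v : ι → W) :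
    ∃ r > 0, Metric.ball u r ⊆ O ∧ ∃ F : Plane → ι → W, F u = v ∧
      (∀ a, ContDiffOn ℝ ∞ (fun w => F w a) (Metric.ball u r)) ∧
      ∀ w ∈ Metric.ball u r, ∀ i a, vpd i (fun w => F w a) w = ∑ b, m i w a b • F w b := by
  have hflat : ∀ x ∈ O, ∀ (p q : Plane) (v : ι → W), fderiv ℝ (totalForm W m) x p q v
      + totalForm W m x q (totalForm W m x p v)
      = fderiv ℝ (totalForm W m) x q p v + totalForm W m x p (totalForm W m x q v) := by
    intro x hx p q v
    ext a
    have hmm : ∀ i j, ∑ b, m i x a b • ∑ c, m j x b c • v c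
        = ∑ b, (∑ c, m i x a c * m j x c b) • v b := by
      intro i j
      simp only [Finset.smul_sum, Finset.sum_smul, smul_smul]
      exact Finset.sum_comm
    have hf : ∑ b, (pd 0 (fun x => m 1 x a b) x) • v b
        + ∑ b, (∑ c, m 1 x a c * m 0 x c b) • v b
        = ∑ b, (pd 1 (fun x => m 0 x a b) x) • v b
        + ∑ b, (∑ c, m 0 x a c * m 1 x c b) • v b := by
      rw [← Finset.sum_add_distrib, ← Finset.sum_add_distrib]
      refine Finset.sum_congr rfl fun b _ => ?_
      rw [← add_smul, ← add_smul]
      congr 1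
      linarith [flat x hx a b]
    simp only [Pi.add_apply, fderiv_totalForm_apply hO hm hx, totalForm_apply, Fin.sum_univ_two,
      add_smul, smul_add, Finset.sum_add_distrib, smul_comm (m _ x a _) (_ : ℝ) (_ : W),
      ← Finset.smul_sum, hmm, mul_smul]
    -- The terms in `p 0 * q 0` and `p 1 * q 1` agree on both sides, so the claim is `p 0 * q 1 - p
    -- 1 * q 0` times the matrix identity `hf`.
    have hf' := congrArg (fun z => (p 0 * q 1) • z) hf
    have hf'' := congrArg (fun z => (p 1 * q 0) • z) hf
    simp only [smul_add, mul_smul] at hf' hf''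
    linear_combination (norm := module) hf' - hf''
  obtain ⟨r, hr, hsub, hex⟩ := exists_ball_hasFDerivAt_eq_apply hO
    (contDiffOn_totalForm (W := W) hm) hflat hu
  obtain ⟨F, hF0, hFs, hF⟩ := hex v
  refine ⟨r, hr, hsub, F, hF0, fun a => contDiffOn_pi.1 hFs a, fun w hw i a => ?_⟩
  rw [vpd_pi (hF w hw), ContinuousLinearMap.flip_apply, totalForm_apply]
  simp

end LinearSystems

/-! ### Linear algebra and product rules for the Lorentzian inner product. -/

noncomputable section LorentzAlgebra

/-- The Lorentzian inner product as a continuous bilinear map. -/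
def lorentzCLM : L4 →L[ℝ] L4 →L[ℝ] ℝ :=
  -((EuclideanSpace.proj 0 : L4 →L[ℝ] ℝ).smulRight (EuclideanSpace.proj 0 : L4 →L[ℝ] ℝ))
    + (EuclideanSpace.proj 1 : L4 →L[ℝ] ℝ).smulRight (EuclideanSpace.proj 1 : L4 →L[ℝ] ℝ)
    + (EuclideanSpace.proj 2 : L4 →L[ℝ] ℝ).smulRight (EuclideanSpace.proj 2 : L4 →L[ℝ] ℝ)
    + (EuclideanSpace.proj 3 : L4 →L[ℝ] ℝ).smulRight (EuclideanSpace.proj 3 : L4 →L[ℝ] ℝ)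

@[simp] theorem lorentzCLM_apply (z w : L4) : lorentzCLM z w = lorentz z w := by
  simp [lorentzCLM, lorentz]

theorem lorentz_comm (z w : L4) : lorentz z w = lorentz w z := by
  simp only [lorentz]; ring

theorem lorentz_add_left (z z' w : L4) : lorentz (z + z') w = lorentz z w + lorentz z' w := by
  simp only [← lorentzCLM_apply, map_add, add_apply]

theorem lorentz_sub_left (z z' w : L4) : lorentz (z - z') w = lorentz z w - lorentz z' w := by
  simp only [← lorentzCLM_apply, map_sub, sub_apply]

theorem lorentz_smul_left (c : ℝ) (z w : L4) : lorentz (c • z) w = c * lorentz z w := by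
  simp only [← lorentzCLM_apply, map_smul, smul_apply, smul_eq_mul]

theorem lorentz_sum_left {ι : Type*} (s : Finset ι) (f : ι → L4) (w : L4) :
    lorentz (∑ i ∈ s, f i) w = ∑ i ∈ s, lorentz (f i) w := by
  simp only [← lorentzCLM_apply, map_sum, sum_apply]

theorem lorentz_add_right (z w w' : L4) : lorentz z (w + w') = lorentz z w + lorentz z w' := by
  simp only [← lorentzCLM_apply, map_add]

theorem lorentz_sub_right (z w w' : L4) : lorentz z (w - w') = lorentz z w - lorentz z w' := by
  simp only [← lorentzCLM_apply, map_sub]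

theorem lorentz_smul_right (c : ℝ) (z w : L4) : lorentz z (c • w) = c * lorentz z w := by
  simp only [← lorentzCLM_apply, map_smul, smul_eq_mul]

theorem lorentz_neg_left (z w : L4) : lorentz (-z) w = -lorentz z w := by
  simp only [← lorentzCLM_apply, map_neg, neg_apply]

theorem lorentz_neg_right (z w : L4) : lorentz z (-w) = -lorentz z w := by
  simp only [← lorentzCLM_apply, map_neg]

theorem lorentz_sum_right {ι : Type*} (s : Finset ι) (f : ι → L4) (w : L4) :
    lorentz w (∑ i ∈ s, f i) = ∑ i ∈ s, lorentz w (f i) := by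
  simp only [← lorentzCLM_apply, map_sum]

theorem eq_zero_of_lorentz_eq_zero {z : L4} (h : ∀ w, lorentz z w = 0) : z = 0 := by
  ext i
  have := h (EuclideanSpace.single i 1)
  fin_cases i <;> simpa [lorentz] using this

/-- Pairing a linear relation with each `F a` shows that its coefficient vector lies in the kernel
of `S`. -/
theorem linearIndependent_of_gram {F : Fin 4 → L4} {S : Matrix (Fin 4) (Fin 4) ℝ}
    (hF : ∀ a b, lorentz (F a) (F b) = S a b) (hS : S.det ≠ 0) : LinearIndependent ℝ F := by
  rw [Fintype.linearIndependent_iff]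
  intro c hc
  refine congrFun (Matrix.eq_zero_of_mulVec_eq_zero hS (funext fun a => ?_))
  have : lorentz (F a) (∑ b, c b • F b) = 0 := by rw [hc]; simp [lorentz]
  rw [lorentz_sum_right] at this
  simpa [lorentz_smul_right, hF, Matrix.mulVec, dotProduct, mul_comm] using this

/-- A family of four vectors with nondegenerate Gram matrix, as a basis. -/
def gramBasis {F : Fin 4 → L4} {S : Matrix (Fin 4) (Fin 4) ℝ}
    (hF : ∀ a b, lorentz (F a) (F b) = S a b) (hS : S.det ≠ 0) : Module.Basis (Fin 4) ℝ L4 :=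
  basisOfLinearIndependentOfCardEqFinrank (linearIndependent_of_gram hF hS) (by simp)

@[simp] theorem gramBasis_apply {F : Fin 4 → L4} {S : Matrix (Fin 4) (Fin 4) ℝ}
    (hF : ∀ a b, lorentz (F a) (F b) = S a b) (hS : S.det ≠ 0) (a : Fin 4) :
    gramBasis hF hS a = F a := by
  simp [gramBasis]

/-- Reduces vector equations, such as the structure equations, to scalar identities against a frame.
-/
theorem eq_of_lorentz_gram_eq {F : Fin 4 → L4} {S : Matrix (Fin 4) (Fin 4) ℝ}
    (hF : ∀ a b, lorentz (F a) (F b) = S a b) (hS : S.det ≠ 0) {z w : L4}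
    (h : ∀ a, lorentz z (F a) = lorentz w (F a)) : z = w := by
  rw [← sub_eq_zero]
  refine eq_zero_of_lorentz_eq_zero fun v => ?_
  rw [← (gramBasis hF hS).sum_repr v, lorentz_sum_right]
  refine Finset.sum_eq_zero fun a _ => ?_
  rw [lorentz_smul_right, gramBasis_apply, lorentz_sub_left, h, sub_self, mul_zero]

theorem lorentz_map_eq_of_gram {F F' : Fin 4 → L4} {S : Matrix (Fin 4) (Fin 4) ℝ}
    (hF : ∀ a b, lorentz (F a) (F b) = S a b) (hS : S.det ≠ 0)
    (hF' : ∀ a b, lorentz (F' a) (F' b) = S a b) {T : L4 →ₗ[ℝ] L4} (hT : ∀ a, T (F a) = F' a)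
    (z w : L4) : lorentz (T z) (T w) = lorentz z w := by
  rw [← (gramBasis hF hS).sum_repr z, ← (gramBasis hF hS).sum_repr w]
  simp only [map_sum, map_smul, gramBasis_apply, hT, lorentz_sum_left, lorentz_sum_right,
    lorentz_smul_left, lorentz_smul_right, hF, hF']

theorem det_gramForm (G : Plane → Matrix (Fin 2) (Fin 2) ℝ) (u : Plane) :
    (gramForm G u).det = -(G u).det := by
  simp [gramForm, Matrix.det_succ_row_zero, Fin.sum_univ_succ, Fin.succAbove]
  ring

theorem differentiableAt_lorentz {f g : Plane → L4} {u : Plane} (hf : DifferentiableAt ℝ f u)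
    (hg : DifferentiableAt ℝ g u) : DifferentiableAt ℝ (fun w => lorentz (f w) (g w)) u := by
  simp only [← lorentzCLM_apply]
  exact (lorentzCLM.differentiableAt.comp u hf).clm_apply hg

theorem pd_lorentz {f g : Plane → L4} {u : Plane} (hf : DifferentiableAt ℝ f u)
    (hg : DifferentiableAt ℝ g u) (k : Fin 2) : pd k (fun w => lorentz (f w) (g w)) u
      = lorentz (vpd k f u) (g u) + lorentz (f u) (vpd k g u) := by
  have h := lorentzCLM.hasFDerivAt_of_bilinear hf.hasFDerivAt hg.hasFDerivAt
  simp only [lorentzCLM_apply] at h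
  rw [pd, h.fderiv]
  simp [vpd, add_comm]

theorem contDiffOn_lorentz {f g : Plane → L4} {O : Set Plane} (hf : ContDiffOn ℝ ∞ f O)
    (hg : ContDiffOn ℝ ∞ g O) : ContDiffOn ℝ ∞ (fun w => lorentz (f w) (g w)) O := by
  simp only [← lorentzCLM_apply]
  exact (lorentzCLM.contDiff.comp_contDiffOn hf).clm_apply hg

theorem lorentz_vpd_self_eq_zero {X : Plane → L4} {O : Set Plane} {u : Plane} (hO : IsOpen O)
    (hX : ContDiffOn ℝ ∞ X O) (h : ∀ w ∈ O, lorentz (X w) (X w) = 0) (hu : u ∈ O) (i : Fin 2) :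
    lorentz (vpd i X u) (X u) = 0 := by
  have d := differentiableAt_of_contDiffOn hO hX hu
  have := pd_congr hO hu h i
  rw [pd_lorentz d d, pd_const, lorentz_comm (X u)] at this
  linarith

end LorentzAlgebra

/-! ### Immersions in a chart: structure equations, rigidity and existence. -/

noncomputable section CoordinateSolutions

open Filter Topology

/-- The coordinate expression on `O` of an immersion `X` into the lightcone, with dual `Y`, metric
`G` and second fundamental form `H`. -/
structure IsCoordSol (G H : Plane → Matrix (Fin 2) (Fin 2) ℝ) (X Y : Plane → L4)
    (O : Set Plane) : Prop where
  contDiffOn_fst : ContDiffOn ℝ ∞ X O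
  contDiffOn_snd : ContDiffOn ℝ ∞ Y O
  lorentz_fst (u : Plane) (hu : u ∈ O) : lorentz (X u) (X u) = 0
  lorentz_snd (u : Plane) (hu : u ∈ O) : lorentz (Y u) (Y u) = 0
  lorentz_eq_one (u : Plane) (hu : u ∈ O) : lorentz (X u) (Y u) = 1
  lorentz_vpd_fst (u : Plane) (hu : u ∈ O) (i : Fin 2) : lorentz (vpd i X u) (Y u) = 0
  lorentz_vpd_snd (u : Plane) (hu : u ∈ O) (i : Fin 2) : lorentz (vpd i Y u) (X u) = 0
  metric (u : Plane) (hu : u ∈ O) (i j : Fin 2) : lorentz (vpd i X u) (vpd j X u) = G u i j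
  sff (u : Plane) (hu : u ∈ O) (i j : Fin 2) : -lorentz (vpd i X u) (vpd j Y u) = H u i j

/-- The frame `(X, ∂₀X, ∂₁X, Y)`. -/
def coordFrame (X Y : Plane → L4) (u : Plane) : Fin 4 → L4 :=
  ![X u, vpd 0 X u, vpd 1 X u, Y u]

variable {G H : Plane → Matrix (Fin 2) (Fin 2) ℝ} {X Y : Plane → L4} {O : Set Plane} {u : Plane}

theorem contDiffOn_coordFrame (hO : IsOpen O) (h : IsCoordSol G H X Y O) (a : Fin 4) :
    ContDiffOn ℝ ∞ (fun w => coordFrame X Y w a) O := by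
  fin_cases a
  exacts [h.contDiffOn_fst, contDiffOn_vpd hO h.contDiffOn_fst 0,
    contDiffOn_vpd hO h.contDiffOn_fst 1, h.contDiffOn_snd]

theorem IsCoordSol.lorentz_vpd_fst_fst (hO : IsOpen O) (h : IsCoordSol G H X Y O) (hu : u ∈ O)
    (i : Fin 2) : lorentz (vpd i X u) (X u) = 0 :=
  lorentz_vpd_self_eq_zero hO h.contDiffOn_fst h.lorentz_fst hu i

theorem IsCoordSol.lorentz_vpd_snd_snd (hO : IsOpen O) (h : IsCoordSol G H X Y O) (hu : u ∈ O)
    (i : Fin 2) : lorentz (vpd i Y u) (Y u) = 0 :=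
  lorentz_vpd_self_eq_zero hO h.contDiffOn_snd h.lorentz_snd hu i

theorem IsCoordSol.gram (hO : IsOpen O) (h : IsCoordSol G H X Y O) (hu : u ∈ O) (a b : Fin 4) :
    lorentz (coordFrame X Y u a) (coordFrame X Y u b) = gramForm G u a b := by
  have h1 := h.lorentz_vpd_fst_fst hO hu
  have h2 := fun i => (lorentz_comm _ _).trans (h1 i)
  have h3 := h.lorentz_vpd_fst u hu
  have h4 := fun i => (lorentz_comm _ _).trans (h3 i)
  have h5 := (lorentz_comm _ _).trans (h.lorentz_eq_one u hu)
  fin_cases a <;> fin_cases b <;>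
    simp [coordFrame, gramForm, h1, h2, h3, h4, h5, h.lorentz_fst u hu, h.lorentz_snd u hu,
      h.lorentz_eq_one u hu, h.metric u hu]

/-- The structure equations. -/
theorem IsCoordSol.vpd_coordFrame (hO : IsOpen O) (hG : SmoothSymOn G O) (hH : SmoothSymOn H O)
    (hdet : ∀ u ∈ O, (G u).det ≠ 0) (h : IsCoordSol G H X Y O) (hu : u ∈ O) (i : Fin 2)
    (a : Fin 4) : vpd i (fun w => coordFrame X Y w a) u
      = ∑ b, connForm G H i u a b • coordFrame X Y u b := by
  have hgd : (gramForm G u).det ≠ 0 := by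
    rw [det_gramForm]; exact neg_ne_zero.2 (hdet u hu)
  have dX := differentiableAt_of_contDiffOn hO h.contDiffOn_fst hu
  have dY := differentiableAt_of_contDiffOn hO h.contDiffOn_snd hu
  have dXi := fun j => differentiableAt_of_contDiffOn hO (contDiffOn_vpd hO h.contDiffOn_fst j) hu
  -- The second derivatives of `X` are determined by their products with the frame. These come from
  -- differentiating `⟨∂ⱼX, X⟩ = 0` and `⟨∂ⱼX, Y⟩ = 0`, and from Koszul's formula in the tangential
  -- directions.
  have k1 : ∀ j, lorentz (vpd i (vpd j X) u) (X u) = -G u i j := fun j => by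
    have := pd_congr hO hu (fun w hw => h.lorentz_vpd_fst_fst hO hw j) i
    rw [pd_lorentz (dXi j) dX, pd_const, lorentz_comm (vpd j X u), h.metric u hu] at this
    linarith
  have k2 : ∀ j, lorentz (vpd i (vpd j X) u) (Y u) = H u i j := fun j => by
    have := pd_congr hO hu (fun w hw => h.lorentz_vpd_fst w hw j) i
    have h2 := h.sff u hu j i
    rw [pd_lorentz (dXi j) dY, pd_const] at this
    rw [hH.symm u i j]
    linarith
  have k3 : ∀ j l, lorentz (vpd i (vpd j X) u) (vpd l X u) = christoffelLow G l i j u := by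
    have m : ∀ a b c, pd a (fun w => G w b c) u
        = lorentz (vpd a (vpd b X) u) (vpd c X u) + lorentz (vpd b X u) (vpd a (vpd c X) u) :=
      fun a b c => by
        rw [← pd_lorentz (dXi b) (dXi c)]
        exact pd_congr hO hu (fun w hw => (h.metric w hw b c).symm) a
    intro j l
    have cm := fun a b => vpd_comm hO h.contDiffOn_fst hu a b
    rw [christoffelLow, m, m, m, cm j i, cm j l, cm i l, lorentz_comm (vpd i X u) (vpd l _ u),
      lorentz_comm (vpd j X u) (vpd l (vpd i X) u)]
    ring
  refine eq_of_lorentz_gram_eq (h.gram hO hu) hgd fun c => ?_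
  have s := fun m j => sum_mul_christoffel (hdet u hu) m i j
  have r := fun m => sum_mul_raise (H := H) (hdet u hu) m i
  have hs := hG.symm u 1 0
  simp only [lorentz_sum_left, lorentz_smul_left, h.gram hO hu]
  simp only [Fin.sum_univ_two] at s r
  have z1 := h.lorentz_vpd_fst_fst hO hu
  have z2 := h.lorentz_vpd_fst u hu
  have z3 := h.lorentz_vpd_snd u hu
  have z4 := h.lorentz_vpd_snd_snd hO hu
  have z5 := fun a b => h.metric u hu a b
  have z6 : ∀ j, lorentz (vpd i Y u) (vpd j X u) = -H u j i := fun j => by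
    rw [lorentz_comm, ← h.sff u hu, neg_neg]
  have v0 : vpd i (fun w => coordFrame X Y w 0) u = vpd i X u := rfl
  have v1 : vpd i (fun w => coordFrame X Y w 1) u = vpd i (vpd 0 X) u := rfl
  have v2 : vpd i (fun w => coordFrame X Y w 2) u = vpd i (vpd 1 X) u := rfl
  have v3 : vpd i (fun w => coordFrame X Y w 3) u = vpd i Y u := rfl
  fin_cases a <;> fin_cases c <;>
    simp only [Fin.zero_eta, Fin.mk_one, Fin.reduceFinMk, v0, v1, v2, v3] <;>
    simp [coordFrame, connForm, gramForm, Fin.sum_univ_four, k1, k2, k3, z1, z2, z3, z4, z5, z6]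
  all_goals
    have s00 := s 0 0
    have s01 := s 0 1
    have s10 := s 1 0
    have s11 := s 1 1
    have r0 := r 0
    have r1 := r 1
    fin_cases i <;> simp [hs] at s00 s01 s10 s11 r0 r1 ⊢ <;> linarith

/-- Expanding `∂₀∂₁F = ∂₁∂₀F` by the structure equations gives a linear relation among the frame
vectors whose coefficients are curvature entries; the frame is linearly independent. -/
theorem IsCoordSol.connCurv_eq_zero (hO : IsOpen O) (hG : SmoothSymOn G O) (hH : SmoothSymOn H O)
    (hdet : ∀ u ∈ O, (G u).det ≠ 0) (h : IsCoordSol G H X Y O) (hu : u ∈ O) (a b : Fin 4) :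
    connCurv G H a b u = 0 := by
  have hgd : (gramForm G u).det ≠ 0 := by
    rw [det_gramForm]; exact neg_ne_zero.2 (hdet u hu)
  have hc := contDiffOn_coordFrame hO h
  have dA := fun i a b => differentiableAt_of_contDiffOn hO
    (contDiffOn_connForm hO hG hH hdet i a b) hu
  have dF := fun a => differentiableAt_of_contDiffOn hO (hc a) hu
  have key : ∀ i j, vpd i (vpd j fun w => coordFrame X Y w a) u
      = ∑ b, (pd i (fun w => connForm G H j w a b) u
        + ∑ c, connForm G H j u a c * connForm G H i u c b) • coordFrame X Y u b := by
    intro i j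
    have e1 := vpd_congr hO hu (fun w hw => h.vpd_coordFrame hO hG hH hdet hw j a) i
    change vpd i (vpd j fun w => coordFrame X Y w a) u = _ at e1
    rw [e1, vpd_sum _ (f := fun b w => connForm G H j w a b • coordFrame X Y w b)
      fun b _ => (dA j a b).smul (dF b)]
    simp only [vpd_smul (dA j a _) (dF _), h.vpd_coordFrame hO hG hH hdet hu, add_smul,
      Finset.sum_add_distrib, Finset.smul_sum, Finset.sum_smul, smul_smul]
    rw [add_comm, Finset.sum_comm]
  have := vpd_comm hO (hc a) hu 0 1
  rw [key, key, ← sub_eq_zero, ← Finset.sum_sub_distrib] at this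
  simp only [← sub_smul] at this
  have hli := Fintype.linearIndependent_iff.1 (linearIndependent_of_gram (h.gram hO hu) hgd) _ this b
  rw [connCurv, ← hli]
  ring

theorem IsCoordSol.codazzi (hO : IsOpen O) (hG : SmoothSymOn G O) (hH : SmoothSymOn H O)
    (hdet : ∀ u ∈ O, (G u).det ≠ 0) (h : IsCoordSol G H X Y O) (hu : u ∈ O) (k i j : Fin 2) :
    covDerivTensor G H k i j u = covDerivTensor G H i k j u := by
  have h1 : ∀ j, covDerivTensor G H 0 1 j u = covDerivTensor G H 1 0 j u := fun j => by
    rw [← sub_eq_zero, covDerivTensor_sub_eq_connCurv hG]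
    exact h.connCurv_eq_zero hO hG hH hdet hu _ _
  fin_cases k <;> fin_cases i
  exacts [rfl, h1 j, (h1 j).symm, rfl]

theorem IsCoordSol.gauss (hO : IsOpen O) (hG : SmoothSymOn G O) (hH : SmoothSymOn H O)
    (hdet : ∀ u ∈ O, (G u).det ≠ 0) (h : IsCoordSol G H X Y O) (hu : u ∈ O) :
    gaussCoord G u = -((G u)⁻¹ * H u).trace := by
  have := gaussCoord_add_trace hG hH (hdet u hu)
  simp only [h.connCurv_eq_zero hO hG hH hdet hu, mul_zero, Finset.sum_const_zero, zero_div] at this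
  linarith

/-- Local rigidity. -/
theorem IsCoordSol.eventually_map_eq (hO : IsOpen O) (hG : SmoothSymOn G O)
    (hH : SmoothSymOn H O) (hdet : ∀ u ∈ O, (G u).det ≠ 0) (h : IsCoordSol G H X Y O)
    {X' Y' : Plane → L4} (h' : IsCoordSol G H X' Y' O) (hu : u ∈ O) {T : L4 →L[ℝ] L4}
    (hT : ∀ a, T (coordFrame X Y u a) = coordFrame X' Y' u a) :
    ∀ᶠ w in 𝓝 u, ∀ a, T (coordFrame X Y w a) = coordFrame X' Y' w a := by
  have hc := contDiffOn_coordFrame hO h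
  have hc' := contDiffOn_coordFrame hO h'
  -- The coefficients of the system are scalars, so `T` maps solutions to solutions and the
  -- difference of the two frames solves the same system.
  have := eventually_eq_zero_of_linearSystem hO (m := connForm G H)
    (contDiffOn_connForm hO hG hH hdet)
    (F := fun w a => T (coordFrame X Y w a) - coordFrame X' Y' w a)
    (fun w hw a => (T.differentiableAt.comp w (differentiableAt_of_contDiffOn hO (hc a) hw)).sub
      (differentiableAt_of_contDiffOn hO (hc' a) hw)) (fun w hw i a => ?_) hu
    (funext fun a => sub_eq_zero.2 (hT a))
  · filter_upwards [this] with w hw a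
    exact sub_eq_zero.1 (congrFun hw a)
  · have d := differentiableAt_of_contDiffOn hO (hc a) hw
    have d' := differentiableAt_of_contDiffOn hO (hc' a) hw
    have e := (T.hasFDerivAt.comp w d.hasFDerivAt).sub d'.hasFDerivAt
    have e2 : vpd i (fun w => T (coordFrame X Y w a) - coordFrame X' Y' w a) w
        = T (vpd i (fun w => coordFrame X Y w a) w) - vpd i (fun w => coordFrame X' Y' w a) w := by
      rw [vpd]; exact congrArg (fun L => L (EuclideanSpace.single i 1)) e.fderiv
    rw [e2, h.vpd_coordFrame hO hG hH hdet hw, h'.vpd_coordFrame hO hG hH hdet hw, map_sum,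
      ← Finset.sum_sub_distrib]
    simp only [map_smul, smul_sub]

/-- The vectors `(1, 1, 0, 0)` and `(-1/2, 1/2, 0, 0)` are null with product one and span a plane
orthogonal to the last two coordinates. In those coordinates a Cholesky factorisation of the metric
supplies the tangent vectors. -/
theorem exists_gram_eq {A : Plane → Matrix (Fin 2) (Fin 2) ℝ} {u : Plane}
    (hs : A u 1 0 = A u 0 1) (h0 : 0 < A u 0 0) (hdet : 0 < (A u).det) :
    ∃ F : Fin 4 → L4, ∀ a b, lorentz (F a) (F b) = gramForm A u a b := by
  have hd : 0 < (A u).det / A u 0 0 := by positivity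
  have e1 := Real.mul_self_sqrt h0.le
  have e2 := Real.mul_self_sqrt hd.le
  have h1 : Real.sqrt (A u 0 0) ≠ 0 := (Real.sqrt_pos.2 h0).ne'
  have e3 : A u 0 1 / Real.sqrt (A u 0 0) * (A u 0 1 / Real.sqrt (A u 0 0))
      + (A u).det / A u 0 0 = A u 1 1 := by
    rw [div_mul_div_comm, e1, Matrix.det_fin_two, hs]
    field_simp
    ring
  refine ⟨![!₂[1, 1, 0, 0], !₂[0, 0, Real.sqrt (A u 0 0), 0],
    !₂[0, 0, A u 0 1 / Real.sqrt (A u 0 0), Real.sqrt ((A u).det / A u 0 0)],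
    !₂[-(1 / 2), 1 / 2, 0, 0]], fun a b => ?_⟩
  have e4 : Real.sqrt (A u 0 0) * (A u 0 1 / Real.sqrt (A u 0 0)) = A u 0 1 := by field_simp
  fin_cases a <;> fin_cases b <;> simp [lorentz, gramForm, -Real.sqrt_div', -Real.sqrt_div]
  · norm_num
  · exact e1
  · exact e4
  · rw [hs, mul_comm]; exact e4
  · rw [e2]; exact e3
  · norm_num

/-- By the product rule and `pd_gramForm`, the sixteen entries of the difference solve the linear
system with matrix `A ⊗ 1 + 1 ⊗ A`, and they vanish at `u`. -/
theorem gram_eq_gramForm (hO : IsOpen O) (hG : SmoothSymOn G O) (hH : SmoothSymOn H O)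
    (hdet : ∀ u ∈ O, (G u).det ≠ 0) {F : Plane → Fin 4 → L4}
    (hF : ∀ w ∈ O, ∀ a, DifferentiableAt ℝ (fun w => F w a) w)
    (hF' : ∀ w ∈ O, ∀ i a, vpd i (fun w => F w a) w = ∑ b, connForm G H i w a b • F w b)
    (hu : u ∈ O) (h0 : ∀ a b, lorentz (F u a) (F u b) = gramForm G u a b) :
    ∀ᶠ w in 𝓝 u, ∀ a b, lorentz (F w a) (F w b) = gramForm G w a b := by
  have dS := fun w (hw : w ∈ O) a b =>
    differentiableAt_of_contDiffOn hO (contDiffOn_gramForm hG a b) hw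
  have := eventually_eq_zero_of_linearSystem (ι := Fin 4 × Fin 4) hO
    (m := fun i u => Matrix.of fun p q => (if p.2 = q.2 then connForm G H i u p.1 q.1 else 0)
      + (if p.1 = q.1 then connForm G H i u p.2 q.2 else 0))
    (fun i p q => ContDiffOn.add (by
        by_cases h : p.2 = q.2
        · simpa [h] using contDiffOn_connForm hO hG hH hdet i p.1 q.1
        · simpa [h] using contDiffOn_const) (by
        by_cases h : p.1 = q.1
        · simpa [h] using contDiffOn_connForm hO hG hH hdet i p.2 q.2
        · simpa [h] using contDiffOn_const))
    (F := fun w p => lorentz (F w p.1) (F w p.2) - gramForm G w p.1 p.2)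
    (fun w hw p => (differentiableAt_lorentz (hF w hw _) (hF w hw _)).sub (dS w hw _ _))
    (fun w hw i p => ?_) hu (funext fun p => sub_eq_zero.2 (h0 _ _))
  · filter_upwards [this] with w hw a b
    exact sub_eq_zero.1 (congrFun hw (a, b))
  · rw [← pd_eq_vpd, pd_sub (differentiableAt_lorentz (hF w hw _) (hF w hw _)) (dS w hw _ _),
      pd_lorentz (hF w hw _) (hF w hw _), hF' w hw, hF' w hw,
      pd_gramForm hG hH (hdet w hw), Fintype.sum_prod_type]
    simp only [Matrix.of_apply, smul_eq_mul, add_mul, ite_mul, zero_mul, Finset.sum_add_distrib,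
      Finset.sum_ite_eq, Finset.mem_univ, if_true, lorentz_sum_left, lorentz_sum_right,
      lorentz_smul_left, lorentz_smul_right, mul_sub, Finset.sum_sub_distrib]
    rw [Finset.sum_comm (f := fun a b => if p.1 = a then connForm G H i w p.2 b
      * lorentz (F w a) (F w b) else 0), Finset.sum_comm (f := fun a b => if p.1 = a then
        connForm G H i w p.2 b * gramForm G w a b else 0)]
    simp only [Finset.sum_ite_eq, Finset.mem_univ, if_true]

/-- Local existence. -/
theorem exists_isCoordSol (hO : IsOpen O) (hG : SmoothSymOn G O) (hH : SmoothSymOn H O)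
    (h00 : ∀ u ∈ O, 0 < G u 0 0) (hdet : ∀ u ∈ O, 0 < (G u).det)
    (flat : ∀ u ∈ O, ∀ a b, connCurv G H a b u = 0) (hu : u ∈ O) :
    ∃ U ⊆ O, IsOpen U ∧ u ∈ U ∧ ∃ X Y, IsCoordSol G H X Y U := by
  have hdet' : ∀ u ∈ O, (G u).det ≠ 0 := fun u hu => (hdet u hu).ne'
  obtain ⟨F₀, hF₀⟩ := exists_gram_eq (hG.symm u 1 0) (h00 u hu) (hdet u hu)
  obtain ⟨r, hr, hsub, F, hFu, hFs, hF⟩ := exists_solution_linearSystem hO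
    (m := connForm G H) (contDiffOn_connForm hO hG hH hdet') flat hu F₀
  have hgram := gram_eq_gramForm Metric.isOpen_ball ⟨hG.symm, fun i j => (hG.contDiffOn i j).mono hsub⟩
    ⟨hH.symm, fun i j => (hH.contDiffOn i j).mono hsub⟩ (fun w hw => hdet' w (hsub hw))
    (fun w hw a => differentiableAt_of_contDiffOn Metric.isOpen_ball (hFs a) hw) hF
    (Metric.mem_ball_self hr) (by simpa only [hFu] using hF₀)
  obtain ⟨U, hUsub, hUo, huU⟩ := mem_nhds_iff.1
    (Filter.inter_mem hgram (Metric.ball_mem_nhds u hr))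
  have hgU : ∀ w ∈ U, ∀ a b, lorentz (F w a) (F w b) = gramForm G w a b := fun w hw => (hUsub hw).1
  have hUb : U ⊆ Metric.ball u r := fun w hw => (hUsub hw).2
  -- The first row of `connForm` says that the middle vectors of an abstract solution are the
  -- partial derivatives of its first vector, so the solution is the frame of an actual map.
  have e1 : ∀ w ∈ U, ∀ i, vpd i (fun w => F w 0) w = F w (tanIdx i) := by
    intro w hw i
    rw [hF w (hUb hw)]
    fin_cases i <;> simp [connForm, Fin.sum_univ_four, tanIdx]
  have e2 : ∀ w ∈ U, ∀ i, vpd i (fun w => F w 3) w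
      = -∑ k, raise G H k i w • F w (tanIdx k) := by
    intro w hw i
    rw [hF w (hUb hw)]
    simp [connForm, Fin.sum_univ_four, Fin.sum_univ_two, tanIdx]
    abel
  have t0 : ∀ w i, gramForm G w (tanIdx i) 0 = 0 := fun w i => by
    fin_cases i <;> simp [gramForm, tanIdx]
  have t3 : ∀ w i, gramForm G w (tanIdx i) 3 = 0 := fun w i => by
    fin_cases i <;> simp [gramForm, tanIdx]
  have tt : ∀ w i j, gramForm G w (tanIdx i) (tanIdx j) = G w i j := fun w i j => by
    fin_cases i <;> fin_cases j <;> simp [gramForm, tanIdx]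
  refine ⟨U, hUb.trans hsub, hUo, huU, fun w => F w 0, fun w => F w 3, (hFs 0).mono hUb,
    (hFs 3).mono hUb, fun w hw => ?_, fun w hw => ?_, fun w hw => ?_, fun w hw i => ?_,
    fun w hw i => ?_, fun w hw i j => ?_, fun w hw i j => ?_⟩
  · rw [hgU w hw]; simp [gramForm]
  · rw [hgU w hw]; simp [gramForm]
  · rw [hgU w hw]; simp [gramForm]
  · rw [e1 w hw, hgU w hw, t3]
  · rw [e2 w hw, lorentz_neg_left, lorentz_sum_left]
    simp [lorentz_smul_left, hgU w hw, t0]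
  · rw [e1 w hw, e1 w hw, hgU w hw, tt]
  · rw [e1 w hw, e2 w hw, lorentz_neg_right, neg_neg, lorentz_sum_right]
    simp only [lorentz_smul_right, hgU w hw, tt, mul_comm (raise G H _ _ _)]
    exact sum_mul_raise (hdet' w (hsub (hUb hw))) i j

end CoordinateSolutions

/-! ### Coordinate vectors and smoothness of tensor components in a chart. -/

noncomputable section Charts

open Filter Topology

set_option maxSynthPendingDepth 3

variable {M : Type*} [TopologicalSpace M] [ChartedSpace Plane M]
  {φ : OpenPartialHomeomorph M Plane} {u : Plane}

theorem mdifferentiable_of_mem_maximalAtlas (hφ : φ ∈ IsManifold.maximalAtlas (𝓡 2) ∞ M) :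
    φ.MDifferentiable (𝓡 2) (𝓡 2) :=
  ⟨(contMDiffOn_of_mem_maximalAtlas hφ).mdifferentiableOn (by simp),
    (contMDiffOn_symm_of_mem_maximalAtlas hφ).mdifferentiableOn (by simp)⟩

theorem clm_apply_eq_sum {E : Type*} [AddCommGroup E] [Module ℝ E] [TopologicalSpace E]
    (L : Plane →L[ℝ] E) (c : Plane) : L c = ∑ i, c i • L (EuclideanSpace.single i 1) := by
  conv_lhs => rw [← (EuclideanSpace.basisFun (Fin 2) ℝ).sum_repr c]
  simp

theorem sum_smul_coordVec (c : Plane) : ∑ i, c i • coordVec φ i u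
    = (mfderiv (𝓡 2) (𝓡 2) φ.symm u : Plane →L[ℝ] TangentSpace (𝓡 2) (φ.symm u)) c :=
  (clm_apply_eq_sum (E := TangentSpace (𝓡 2) (φ.symm u)) _ c).symm

theorem exists_eq_sum_coordVec (hφ : φ ∈ IsManifold.maximalAtlas (𝓡 2) ∞ M) (hu : u ∈ φ.target)
    (v : TangentSpace (𝓡 2) (φ.symm u)) : ∃ c : Fin 2 → ℝ, v = ∑ i, c i • coordVec φ i u := by
  obtain ⟨w, hw⟩ := (mdifferentiable_of_mem_maximalAtlas hφ).symm.mfderiv_surjective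
    (x := u) (by simpa using hu) v
  exact ⟨fun i => (show Plane from w) i, hw.symm.trans (sum_smul_coordVec (show Plane from w)).symm⟩

theorem eq_zero_of_sum_smul_coordVec_eq_zero (hφ : φ ∈ IsManifold.maximalAtlas (𝓡 2) ∞ M)
    (hu : u ∈ φ.target) (c : Plane) (h : ∑ i, c i • coordVec φ i u = 0) : c = 0 := by
  have hinj := (mdifferentiable_of_mem_maximalAtlas hφ).symm.mfderiv_injective
    (x := u) (by simpa using hu)
  exact hinj (((sum_smul_coordVec c).symm.trans h).trans (map_zero _).symm)

theorem vpd_comp_symm {x : M → L4} (hφ : φ ∈ IsManifold.maximalAtlas (𝓡 2) ∞ M)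
    (hu : u ∈ φ.target) (hx : MDifferentiableAt (𝓡 2) 𝓘(ℝ, L4) x (φ.symm u)) (i : Fin 2) :
    vpd i (fun w => x (φ.symm w)) u = mvfderiv (𝓡 2) x (φ.symm u) (coordVec φ i u) := by
  have h1 := (mdifferentiable_of_mem_maximalAtlas hφ).mdifferentiableAt_symm hu
  have h2 := mfderiv_comp_apply u hx h1 (EuclideanSpace.single i (1 : ℝ) : Plane)
  rw [mfderiv_eq_fderiv] at h2
  exact h2

variable [IsManifold (𝓡 2) ∞ M]

theorem contMDiffAt_coordVec (hφ : φ ∈ IsManifold.maximalAtlas (𝓡 2) ∞ M) (hu : u ∈ φ.target)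
    (i : Fin 2) : ContMDiffAt (𝓡 2) (𝓡 2).tangent ∞
      (fun w => (⟨φ.symm w, coordVec φ i w⟩ : TangentBundle (𝓡 2) M)) u := by
  have h1 : ContMDiffAt (𝓡 2) (𝓡 2) ∞ φ.symm u :=
    (contMDiffOn_symm_of_mem_maximalAtlas hφ).contMDiffAt (φ.open_target.mem_nhds hu)
  have h2 := h1.mfderiv_const (m := ∞) (by simp)
  have h3 : ContMDiffAt (𝓡 2) (𝓡 2).tangent ∞
      (fun w : Plane => (⟨w, (EuclideanSpace.single i (1 : ℝ) : Plane)⟩ :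
        TangentBundle (𝓡 2) Plane)) u :=
    (contMDiffAt_vectorSpace_iff_contDiffAt
      (V := fun w : Plane => (EuclideanSpace.single i (1 : ℝ) : Plane))).2 contDiffAt_const
  exact h2.clm_apply_of_inCoordinates h3 h1

theorem contDiffOn_components
    {T : ∀ p : M, TangentSpace (𝓡 2) p →L[ℝ] TangentSpace (𝓡 2) p →L[ℝ] ℝ}
    (hT : ContMDiff (𝓡 2) ((𝓡 2).prod 𝓘(ℝ, Plane →L[ℝ] Plane →L[ℝ] ℝ)) ∞
    (fun p => Bundle.TotalSpace.mk' (Plane →L[ℝ] Plane →L[ℝ] ℝ)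
      (E := fun p : M => TangentSpace (𝓡 2) p →L[ℝ] TangentSpace (𝓡 2) p →L[ℝ] ℝ) p (T p)))
    (hφ : φ ∈ IsManifold.maximalAtlas (𝓡 2) ∞ M) (i j : Fin 2) :
    ContDiffOn ℝ ∞ (fun u => components T φ u i j) φ.target := by
  intro u hu
  have h1 : ContMDiffAt (𝓡 2) (𝓡 2) ∞ φ.symm u :=
    (contMDiffOn_symm_of_mem_maximalAtlas hφ).contMDiffAt (φ.open_target.mem_nhds hu)
  have h2 := (hT.contMDiffAt (x := φ.symm u)).comp u h1
  have h3 := ContMDiffAt.clm_bundle_apply₂ (F₃ := ℝ) (E₃ := Bundle.Trivial M ℝ) (b := φ.symm) h2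
    (contMDiffAt_coordVec hφ hu i) (contMDiffAt_coordVec hφ hu j)
  rw [Bundle.contMDiffAt_totalSpace] at h3
  exact h3.2.contDiffAt.contDiffWithinAt

end Charts

/-! ### Metric, symmetric tensors and trace in a chart. -/

noncomputable section ChartTensors

open Filter Topology

variable {M : Type*} [TopologicalSpace M] [ChartedSpace Plane M]
  {φ : OpenPartialHomeomorph M Plane} {u : Plane}

theorem bilin_eq_of_coordVec (hφ : φ ∈ IsManifold.maximalAtlas (𝓡 2) ∞ M) (hu : u ∈ φ.target)
    {A B : TangentSpace (𝓡 2) (φ.symm u) →L[ℝ] TangentSpace (𝓡 2) (φ.symm u) →L[ℝ] ℝ}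
    (h : ∀ i j, A (coordVec φ i u) (coordVec φ j u) = B (coordVec φ i u) (coordVec φ j u)) :
    A = B := by
  ext v w
  obtain ⟨c, rfl⟩ := exists_eq_sum_coordVec hφ hu v
  obtain ⟨d, rfl⟩ := exists_eq_sum_coordVec hφ hu w
  simp only [map_sum, map_smul, sum_apply, smul_apply, h]

theorem eq_zero_of_coordVec (hφ : φ ∈ IsManifold.maximalAtlas (𝓡 2) ∞ M) (hu : u ∈ φ.target)
    {A : TangentSpace (𝓡 2) (φ.symm u) →L[ℝ] ℝ} (h : ∀ i, A (coordVec φ i u) = 0) : A = 0 := by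
  ext v
  obtain ⟨c, rfl⟩ := exists_eq_sum_coordVec hφ hu v
  simp [h]

/-- The matrix of the coordinate vectors of `φ` in the standard bases of the tangent spaces. -/
def coordMatrix (φ : OpenPartialHomeomorph M Plane) (u : Plane) : Matrix (Fin 2) (Fin 2) ℝ :=
  Matrix.of fun i j => (show Plane from coordVec φ i u) j

theorem coordVec_eq_sum (φ : OpenPartialHomeomorph M Plane) (u : Plane) (i : Fin 2) :
    coordVec φ i u = ∑ k, coordMatrix φ u i k • stdVec (φ.symm u) k :=
  clm_apply_eq_sum (E := TangentSpace (𝓡 2) (φ.symm u)) (ContinuousLinearMap.id ℝ Plane) _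

theorem components_eq_mul (T : ∀ p : M, TangentSpace (𝓡 2) p →L[ℝ] TangentSpace (𝓡 2) p →L[ℝ] ℝ)
    (φ : OpenPartialHomeomorph M Plane) (u : Plane) : components T φ u
      = coordMatrix φ u
        * (Matrix.of fun i j => T (φ.symm u) (stdVec (φ.symm u) i) (stdVec (φ.symm u) j))
        * (coordMatrix φ u).transpose := by
  ext i j
  simp only [components, Matrix.of_apply, Matrix.mul_apply, Matrix.transpose_apply]
  rw [coordVec_eq_sum, coordVec_eq_sum φ u j, Fin.sum_univ_two, Fin.sum_univ_two]
  simp only [map_add, map_smul, add_apply, smul_apply, smul_eq_mul, Fin.sum_univ_two]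
  ring

variable [IsManifold (𝓡 2) ∞ M] (g : Metric M) (h : SymTensor M)

theorem smoothSymOn_metric (hφ : φ ∈ IsManifold.maximalAtlas (𝓡 2) ∞ M) :
    SmoothSymOn (components g.inner φ) φ.target :=
  ⟨fun _ _ _ => g.symm _ _ _, contDiffOn_components g.contMDiff hφ⟩

theorem smoothSymOn_symTensor (hφ : φ ∈ IsManifold.maximalAtlas (𝓡 2) ∞ M) :
    SmoothSymOn (components h.toFun φ) φ.target :=
  ⟨fun _ _ _ => h.symm _ _ _, contDiffOn_components h.contMDiff hφ⟩

theorem components_metric_pos (hφ : φ ∈ IsManifold.maximalAtlas (𝓡 2) ∞ M) (hu : u ∈ φ.target) :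
    0 < components g.inner φ u 0 0 := by
  refine g.pos _ _ fun h0 => ?_
  have := eq_zero_of_sum_smul_coordVec_eq_zero hφ hu (EuclideanSpace.single 0 1)
    (by simp [h0])
  simpa using congrArg (fun z : Plane => z 0) this

theorem det_components_metric_pos (hφ : φ ∈ IsManifold.maximalAtlas (𝓡 2) ∞ M)
    (hu : u ∈ φ.target) : 0 < (components g.inner φ u).det := by
  have h0 := components_metric_pos g hφ hu
  set G := components g.inner φ u with hG
  have hs : G 1 0 = G 0 1 := g.symm _ _ _
  -- Gram-Schmidt: this vector is orthogonal to `∂₀` and has squared length `G₀₀ det G`.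
  have h1 : 0 < g.inner (φ.symm u) (G 0 0 • coordVec φ 1 u - G 0 1 • coordVec φ 0 u)
      (G 0 0 • coordVec φ 1 u - G 0 1 • coordVec φ 0 u) := by
    refine g.pos _ _ fun hz => ?_
    have := eq_zero_of_sum_smul_coordVec_eq_zero hφ hu
      (!₂[-G 0 1, G 0 0] : Plane) (by
        rw [← hz]; simp [Fin.sum_univ_two, sub_eq_add_neg, add_comm])
    have h2 := congrArg (fun z : Plane => z 1) this
    simp at h2
    exact h0.ne' h2
  have e : ∀ i j, g.inner (φ.symm u) (coordVec φ i u) (coordVec φ j u) = G i j := fun _ _ => rfl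
  simp only [map_sub, map_smul, sub_apply, smul_apply, e, smul_eq_mul, hs] at h1
  rw [Matrix.det_fin_two, hs]
  nlinarith

/-- Passing from the standard basis to the coordinate basis replaces both matrices by `P _ Pᵀ`,
which conjugates `g⁻¹h` and so preserves its trace. -/
theorem metricTrace_eq (hφ : φ ∈ IsManifold.maximalAtlas (𝓡 2) ∞ M) (hu : u ∈ φ.target) :
    metricTrace g h (φ.symm u)
      = ((components g.inner φ u)⁻¹ * components h.toFun φ u).trace := by
  have hd := (det_components_metric_pos g hφ hu).ne'
  rw [components_eq_mul] at hd
  rw [components_eq_mul, components_eq_mul h.toFun, metricTrace]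
  set P := coordMatrix φ u
  rw [Matrix.det_mul, Matrix.det_mul, Matrix.det_transpose] at hd
  have hP : IsUnit P.det := isUnit_iff_ne_zero.2 (right_ne_zero_of_mul hd)
  have hP' : IsUnit P.transpose.det := by rwa [Matrix.det_transpose]
  rw [Matrix.mul_inv_rev, Matrix.mul_inv_rev, Matrix.mul_assoc P, Matrix.mul_assoc (P.transpose⁻¹),
    Matrix.mul_assoc _ P⁻¹, Matrix.nonsing_inv_mul_cancel_left _ _ hP,
    Matrix.trace_mul_comm P.transpose⁻¹, Matrix.mul_assoc, Matrix.mul_assoc,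
    Matrix.mul_nonsing_inv _ hP', Matrix.mul_one]

end ChartTensors

/-! ### Pointwise conditions on the manifold and their translation to charts. -/

noncomputable section Germs

open Filter Topology

variable {M : Type*} [TopologicalSpace M] [ChartedSpace Plane M]

theorem mvfderiv_apply_eq (x : M → L4) (p : M) (v : TangentSpace (𝓡 2) p) :
    mvfderiv (𝓡 2) x p v = (mfderiv (𝓡 2) 𝓘(ℝ, L4) x p v : L4) := rfl

theorem mvfderiv_apply_congr {x x' : M → L4} {p : M} (hx : x' =ᶠ[𝓝 p] x)
    (v : TangentSpace (𝓡 2) p) : mvfderiv (𝓡 2) x' p v = mvfderiv (𝓡 2) x p v := by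
  rw [mvfderiv_apply_eq, hx.mfderiv_eq]
  rfl

theorem mvfderiv_clm_comp {x : M → L4} {p : M} (T : L4 →L[ℝ] L4)
    (hx : MDifferentiableAt (𝓡 2) 𝓘(ℝ, L4) x p) (v : TangentSpace (𝓡 2) p) :
    mvfderiv (𝓡 2) (fun q => T (x q)) p v = T (mvfderiv (𝓡 2) x p v) := by
  have h := mfderiv_comp_apply p (g := T) (T.mdifferentiableAt (x := x p)) hx v
  rw [T.mfderiv_eq] at h
  exact h

/-- The pullback of the Lorentzian inner product under a pair of linear maps. -/
def pullLorentz (A B : Plane →L[ℝ] L4) : Plane →L[ℝ] Plane →L[ℝ] ℝ :=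
  lorentzCLM.bilinearComp A B

@[simp] theorem pullLorentz_apply (A B : Plane →L[ℝ] L4) (v w : Plane) :
    pullLorentz A B v w = lorentz (A v) (B w) := by
  simp [pullLorentz]

variable [IsManifold (𝓡 2) ∞ M]

/-- `x`, `y` satisfy at `p` the pointwise conditions for an isometric immersion into the lightcone
with dual `y` and second fundamental form `h`. -/
structure IsSolAt (g : Metric M) (h : SymTensor M) (x y : M → L4) (p : M) : Prop where
  contMDiffAt_fst : ContMDiffAt (𝓡 2) 𝓘(ℝ, L4) ∞ x p
  contMDiffAt_snd : ContMDiffAt (𝓡 2) 𝓘(ℝ, L4) ∞ y p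
  lorentz_fst : lorentz (x p) (x p) = 0
  lorentz_snd : lorentz (y p) (y p) = 0
  lorentz_eq_one : lorentz (x p) (y p) = 1
  lorentz_dx (v : TangentSpace (𝓡 2) p) : lorentz (mvfderiv (𝓡 2) x p v) (y p) = 0
  lorentz_dy (v : TangentSpace (𝓡 2) p) : lorentz (mvfderiv (𝓡 2) y p v) (x p) = 0
  metric (v w : TangentSpace (𝓡 2) p) :
    lorentz (mvfderiv (𝓡 2) x p v) (mvfderiv (𝓡 2) x p w) = g.inner p v w
  sff (v w : TangentSpace (𝓡 2) p) :
    -lorentz (mvfderiv (𝓡 2) x p v) (mvfderiv (𝓡 2) y p w) = h.toFun p v w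

variable {g : Metric M} {h : SymTensor M} {x y : M → L4} {p : M}

theorem IsSolAt.mdifferentiableAt_fst (hs : IsSolAt g h x y p) :
    MDifferentiableAt (𝓡 2) 𝓘(ℝ, L4) x p := hs.contMDiffAt_fst.mdifferentiableAt (by simp)

theorem IsSolAt.mdifferentiableAt_snd (hs : IsSolAt g h x y p) :
    MDifferentiableAt (𝓡 2) 𝓘(ℝ, L4) y p := hs.contMDiffAt_snd.mdifferentiableAt (by simp)

theorem IsSolAt.congr (hs : IsSolAt g h x y p) {x' y' : M → L4} (hx : x' =ᶠ[𝓝 p] x)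
    (hy : y' =ᶠ[𝓝 p] y) : IsSolAt g h x' y' p := by
  refine ⟨hs.contMDiffAt_fst.congr_of_eventuallyEq hx, hs.contMDiffAt_snd.congr_of_eventuallyEq hy,
    ?_, ?_, ?_, fun v => ?_, fun v => ?_, fun v w => ?_, fun v w => ?_⟩ <;>
    simp only [mvfderiv_apply_congr hx, mvfderiv_apply_congr hy, hx.eq_of_nhds, hy.eq_of_nhds]
  exacts [hs.lorentz_fst, hs.lorentz_snd, hs.lorentz_eq_one, hs.lorentz_dx v, hs.lorentz_dy v,
    hs.metric v w, hs.sff v w]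

theorem IsSolAt.map (hs : IsSolAt g h x y p) (T : L4 →L[ℝ] L4)
    (hT : ∀ z w, lorentz (T z) (T w) = lorentz z w) :
    IsSolAt g h (fun q => T (x q)) (fun q => T (y q)) p := by
  refine ⟨T.contMDiff.contMDiffAt.comp p hs.contMDiffAt_fst,
    T.contMDiff.contMDiffAt.comp p hs.contMDiffAt_snd,
    ?_, ?_, ?_, fun v => ?_, fun v => ?_, fun v w => ?_, fun v w => ?_⟩ <;>
    simp only [mvfderiv_clm_comp T hs.mdifferentiableAt_fst,
      mvfderiv_clm_comp T hs.mdifferentiableAt_snd, hT]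
  exacts [hs.lorentz_fst, hs.lorentz_snd, hs.lorentz_eq_one, hs.lorentz_dx v, hs.lorentz_dy v,
    hs.metric v w, hs.sff v w]

theorem isCoordSol_of_isSolAt {φ : OpenPartialHomeomorph M Plane} {O : Set Plane}
    (hφ : φ ∈ IsManifold.maximalAtlas (𝓡 2) ∞ M) (hO : O ⊆ φ.target)
    (hs : ∀ u ∈ O, IsSolAt g h x y (φ.symm u)) :
    IsCoordSol (components g.inner φ) (components h.toFun φ) (fun u => x (φ.symm u))
      (fun u => y (φ.symm u)) O := by
  have hsm : ∀ u ∈ O, ContMDiffAt (𝓡 2) (𝓡 2) ∞ φ.symm u := fun u hu =>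
    (contMDiffOn_symm_of_mem_maximalAtlas hφ).contMDiffAt (φ.open_target.mem_nhds (hO hu))
  have e1 := fun u hu => vpd_comp_symm hφ (hO hu) (hs u hu).mdifferentiableAt_fst
  have e2 := fun u hu => vpd_comp_symm hφ (hO hu) (hs u hu).mdifferentiableAt_snd
  refine ⟨fun u hu => ((hs u hu).contMDiffAt_fst.comp u (hsm u hu)).contDiffAt.contDiffWithinAt,
    fun u hu => ((hs u hu).contMDiffAt_snd.comp u (hsm u hu)).contDiffAt.contDiffWithinAt,
    fun u hu => (hs u hu).lorentz_fst, fun u hu => (hs u hu).lorentz_snd,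
    fun u hu => (hs u hu).lorentz_eq_one, fun u hu i => ?_, fun u hu i => ?_, fun u hu i j => ?_,
    fun u hu i j => ?_⟩
  · rw [e1 u hu]; exact (hs u hu).lorentz_dx _
  · rw [e2 u hu]; exact (hs u hu).lorentz_dy _
  · rw [e1 u hu, e1 u hu]; exact (hs u hu).metric _ _
  · rw [e1 u hu, e2 u hu]; exact (hs u hu).sff _ _

theorem isSolAt_of_isCoordSol {φ : OpenPartialHomeomorph M Plane} {O : Set Plane}
    (hφ : φ ∈ IsManifold.maximalAtlas (𝓡 2) ∞ M) (hO : O ⊆ φ.target) (hOo : IsOpen O)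
    {X Y : Plane → L4}
    (hs : IsCoordSol (components g.inner φ) (components h.toFun φ) X Y O) {u : Plane}
    (hu : u ∈ O) : IsSolAt g h (fun q => X (φ q)) (fun q => Y (φ q)) (φ.symm u) := by
  have hφu : ContMDiffAt (𝓡 2) (𝓡 2) ∞ φ (φ.symm u) :=
    contMDiffAt_of_mem_maximalAtlas hφ (φ.map_target (hO hu))
  have hr : φ (φ.symm u) = u := φ.right_inv (hO hu)
  have cX : ContMDiffAt (𝓡 2) 𝓘(ℝ, L4) ∞ (fun q => X (φ q)) (φ.symm u) := by
    refine ContMDiffAt.comp (φ.symm u) (g := X) (f := φ) ?_ hφu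
    rw [hr]; exact (hs.contDiffOn_fst.contDiffAt (hOo.mem_nhds hu)).contMDiffAt
  have cY : ContMDiffAt (𝓡 2) 𝓘(ℝ, L4) ∞ (fun q => Y (φ q)) (φ.symm u) := by
    refine ContMDiffAt.comp (φ.symm u) (g := Y) (f := φ) ?_ hφu
    rw [hr]; exact (hs.contDiffOn_snd.contDiffAt (hOo.mem_nhds hu)).contMDiffAt
  have e1 : ∀ i, mvfderiv (𝓡 2) (fun q => X (φ q)) (φ.symm u) (coordVec φ i u) = vpd i X u :=
    fun i => (vpd_comp_symm hφ (hO hu) (cX.mdifferentiableAt (by simp)) i).symm.trans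
      (vpd_congr hOo hu (fun w hw => by rw [φ.right_inv (hO hw)]) i)
  have e2 : ∀ i, mvfderiv (𝓡 2) (fun q => Y (φ q)) (φ.symm u) (coordVec φ i u) = vpd i Y u :=
    fun i => (vpd_comp_symm hφ (hO hu) (cY.mdifferentiableAt (by simp)) i).symm.trans
      (vpd_congr hOo hu (fun w hw => by rw [φ.right_inv (hO hw)]) i)
  refine ⟨cX, cY, ?_, ?_, ?_, fun v => ?_, fun v => ?_, fun v w => ?_, fun v w => ?_⟩
  · rw [hr]; exact hs.lorentz_fst u hu
  · rw [hr]; exact hs.lorentz_snd u hu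
  · rw [hr]; exact hs.lorentz_eq_one u hu
  · have := eq_zero_of_coordVec hφ (hO hu) (A := (lorentzCLM.flip (Y u)).comp
      (mvfderiv (𝓡 2) (fun q => X (φ q)) (φ.symm u))) (fun i => by
        simpa [e1] using hs.lorentz_vpd_fst u hu i)
    rw [hr]
    simpa using congrArg (fun L => L v) this
  · have := eq_zero_of_coordVec hφ (hO hu) (A := (lorentzCLM.flip (X u)).comp
      (mvfderiv (𝓡 2) (fun q => Y (φ q)) (φ.symm u))) (fun i => by
        simpa [e2] using hs.lorentz_vpd_snd u hu i)
    rw [hr]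
    simpa using congrArg (fun L => L v) this
  · exact congrArg (fun L => L v w) (bilin_eq_of_coordVec hφ (hO hu)
      (A := pullLorentz (mvfderiv (𝓡 2) (fun q => X (φ q)) (φ.symm u))
        (mvfderiv (𝓡 2) (fun q => X (φ q)) (φ.symm u)))
      (B := g.inner (φ.symm u)) fun i j => by
        refine Eq.trans ?_ (hs.metric u hu i j)
        rw [← e1, ← e1]
        exact pullLorentz_apply _ _ _ _)
  · exact congrArg (fun L => L v w) (bilin_eq_of_coordVec hφ (hO hu)
      (A := -pullLorentz (mvfderiv (𝓡 2) (fun q => X (φ q)) (φ.symm u))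
        (mvfderiv (𝓡 2) (fun q => Y (φ q)) (φ.symm u)))
      (B := h.toFun (φ.symm u)) fun i j => by
        refine Eq.trans ?_ (hs.sff u hu i j)
        rw [← e1, ← e2]
        exact congrArg Neg.neg (pullLorentz_apply _ _ _ _))

end Germs

/-! ### Lorentz isometries between local solutions. -/

noncomputable section Transition

open Filter Topology

/-- The group of linear isometries of the Lorentz-Minkowski space. -/
def lorentzGroup : Subgroup (L4 ≃ₗ[ℝ] L4) where
  carrier := {T | ∀ z w, lorentz (T z) (T w) = lorentz z w}
  one_mem' := fun _ _ => rfl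
  mul_mem' := fun {S T} hS hT z w => (hS (T z) (T w)).trans (hT z w)
  inv_mem' := fun {T} hT z w => by
    have := hT (T⁻¹ z) (T⁻¹ w)
    rw [← LinearEquiv.mul_apply, ← LinearEquiv.mul_apply, mul_inv_cancel] at this
    exact this.symm

theorem vpd_clm_comp {f : Plane → L4} {u : Plane} (T : L4 →L[ℝ] L4) (hf : DifferentiableAt ℝ f u)
    (k : Fin 2) : vpd k (fun w => T (f w)) u = T (vpd k f u) :=
  congrArg (fun L => L (EuclideanSpace.single k 1)) (T.hasFDerivAt.comp u hf.hasFDerivAt).fderiv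

/-- Agreement on `X` throughout a neighbourhood gives agreement on its derivatives; with `Y` this
covers the whole frame, a basis. -/
theorem clm_eq_of_comp_eq {G H : Plane → Matrix (Fin 2) (Fin 2) ℝ} {X Y : Plane → L4}
    {O : Set Plane} {u : Plane} (hO : IsOpen O) (h : IsCoordSol G H X Y O) (hu : u ∈ O)
    (hdet : (G u).det ≠ 0) {S T : L4 →L[ℝ] L4} (hX : ∀ w ∈ O, S (X w) = T (X w))
    (hY : ∀ w ∈ O, S (Y w) = T (Y w)) : S = T := by
  have hgd : (gramForm G u).det ≠ 0 := by
    rw [det_gramForm]; exact neg_ne_zero.2 hdet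
  have d := differentiableAt_of_contDiffOn hO h.contDiffOn_fst hu
  have e : ∀ i, S (vpd i X u) = T (vpd i X u) := fun i => by
    rw [← vpd_clm_comp S d, ← vpd_clm_comp T d, vpd_congr hO hu hX]
  refine ContinuousLinearMap.coe_injective ((gramBasis (h.gram hO hu) hgd).ext fun a => ?_)
  rw [gramBasis_apply]
  fin_cases a
  exacts [hX u hu, e 0, e 1, hY u hu]

variable {M : Type*} [TopologicalSpace M] [ChartedSpace Plane M]

theorem exists_isOpen_chart_of_eventually {q : M} {P : M → Prop} (hP : ∀ᶠ p in 𝓝 q, P p) :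
    ∃ O ⊆ (chartAt Plane q).target, IsOpen O ∧ chartAt Plane q q ∈ O ∧
      ∀ w ∈ O, P ((chartAt Plane q).symm w) := by
  obtain ⟨V, hV, hVo, hq⟩ := eventually_nhds_iff.1 hP
  refine ⟨_, Set.inter_subset_left, (chartAt Plane q).isOpen_inter_preimage_symm hVo,
    ⟨mem_chart_target _ _, ?_⟩, fun w hw => hV _ hw.2⟩
  rw [Set.mem_preimage, (chartAt Plane q).left_inv (mem_chart_source _ _)]
  exact hq

variable [IsManifold (𝓡 2) ∞ M] {g : Metric M} {h : SymTensor M} {x y x' y' : M → L4} {q : M}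

/-- This uniqueness makes the chosen transition isometries locally constant and yields their cocycle
relations. -/
theorem lorentzGroup_eq_of_eventually (hs : ∀ᶠ p in 𝓝 q, IsSolAt g h x y p) {S T : lorentzGroup}
    (hx : ∀ᶠ p in 𝓝 q, S.1 (x p) = T.1 (x p)) (hy : ∀ᶠ p in 𝓝 q, S.1 (y p) = T.1 (y p)) :
    S = T := by
  obtain ⟨O, hOt, hO, hq, hOP⟩ := exists_isOpen_chart_of_eventually (hs.and (hx.and hy))
  have hφ := IsManifold.chart_mem_maximalAtlas (I := 𝓡 2) (n := ∞) q
  have := clm_eq_of_comp_eq hO (isCoordSol_of_isSolAt hφ hOt fun u hu => (hOP u hu).1) hq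
    (det_components_metric_pos g hφ (hOt hq)).ne'
    (S := LinearMap.toContinuousLinearMap (S.1 : L4 →ₗ[ℝ] L4))
    (T := LinearMap.toContinuousLinearMap (T.1 : L4 →ₗ[ℝ] L4))
    (fun w hw => (hOP w hw).2.1) (fun w hw => (hOP w hw).2.2)
  refine Subtype.ext (LinearEquiv.ext fun z => ?_)
  exact congrArg (fun L : L4 →L[ℝ] L4 => L z) this

/-- The linear map carrying one frame at `q` to the other is an isometry, since both frames have the
Gram matrix fixed by the metric; local rigidity extends the agreement to a neighbourhood. -/
theorem exists_lorentzGroup_eventually_eq (hs : ∀ᶠ p in 𝓝 q, IsSolAt g h x y p)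
    (hs' : ∀ᶠ p in 𝓝 q, IsSolAt g h x' y' p) :
    ∃ T : lorentzGroup, ∀ᶠ p in 𝓝 q, T.1 (x p) = x' p ∧ T.1 (y p) = y' p := by
  obtain ⟨O, hOt, hO, hq, hOP⟩ := exists_isOpen_chart_of_eventually (hs.and hs')
  set φ := chartAt Plane q with hφd
  have hφ : φ ∈ IsManifold.maximalAtlas (𝓡 2) ∞ M := IsManifold.chart_mem_maximalAtlas q
  have hc := isCoordSol_of_isSolAt hφ hOt fun u hu => (hOP u hu).1
  have hc' := isCoordSol_of_isSolAt hφ hOt fun u hu => (hOP u hu).2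
  have hdet := fun u (hu : u ∈ O) => (det_components_metric_pos g hφ (hOt hu)).ne'
  have hgd : (gramForm (components g.inner φ) (φ q)).det ≠ 0 := by
    rw [det_gramForm]; exact neg_ne_zero.2 (hdet _ hq)
  have hb := hc.gram hO hq
  have hb' := hc'.gram hO hq
  set T : L4 ≃ₗ[ℝ] L4 := (gramBasis hb hgd).equiv (gramBasis hb' hgd) (Equiv.refl _) with hTd
  have hT : ∀ a, T (coordFrame (fun u => x (φ.symm u)) (fun u => y (φ.symm u)) (φ q) a)
      = coordFrame (fun u => x' (φ.symm u)) (fun u => y' (φ.symm u)) (φ q) a := fun a => by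
    have := (gramBasis hb hgd).equiv_apply a (gramBasis hb' hgd) (Equiv.refl _)
    rwa [gramBasis_apply, Equiv.refl_apply, gramBasis_apply] at this
  refine ⟨⟨T, lorentz_map_eq_of_gram hb hgd hb' (T := (T : L4 →ₗ[ℝ] L4)) hT⟩, ?_⟩
  have hG := smoothSymOn_metric g hφ
  have hH := smoothSymOn_symTensor h hφ
  have := hc.eventually_map_eq hO ⟨hG.symm, fun i j => (hG.contDiffOn i j).mono hOt⟩
    ⟨hH.symm, fun i j => (hH.contDiffOn i j).mono hOt⟩ hdet hc' hq
    (T := LinearMap.toContinuousLinearMap (T : L4 →ₗ[ℝ] L4)) hT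
  have hcont := (φ.continuousAt (mem_chart_source Plane q)).eventually this
  filter_upwards [hcont, φ.open_source.mem_nhds (mem_chart_source Plane q)] with p hp hps
  have h0 := hp 0
  have h3 := hp 3
  simp only [coordFrame, Matrix.cons_val, φ.left_inv hps] at h0 h3
  exact ⟨h0, h3⟩

theorem exists_isSolAt_nhds (hcod : IsCodazzi g h)
    (hgauss : IsGaussianCurvature g (fun p => -metricTrace g h p)) (q : M) :
    ∃ U : Set M, IsOpen U ∧ q ∈ U ∧ ∃ x y : M → L4, ∀ p ∈ U, IsSolAt g h x y p := by
  set φ := chartAt Plane q with hφd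
  have hφ : φ ∈ IsManifold.maximalAtlas (𝓡 2) ∞ M := IsManifold.chart_mem_maximalAtlas q
  have hG := smoothSymOn_metric g hφ
  have hH := smoothSymOn_symTensor h hφ
  have hdet := fun u (hu : u ∈ φ.target) => det_components_metric_pos g hφ hu
  obtain ⟨U, hUt, hU, hqU, X, Y, hs⟩ := exists_isCoordSol φ.open_target hG hH
    (fun u hu => components_metric_pos g hφ hu) hdet
    (fun u hu a b => connCurv_eq_zero φ.open_target hG hH (fun u hu => (hdet u hu).ne')
      (fun u hu j => (hcod φ hφ u hu 0 1 j).1) (fun u hu => by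
        have := hgauss φ hφ (φ.symm u) (φ.map_target hu)
        rw [φ.right_inv hu] at this
        exact this.symm.trans (congrArg Neg.neg (metricTrace_eq g h hφ hu))) hu a b) (mem_chart_target Plane q)
  refine ⟨φ.source ∩ φ ⁻¹' U, φ.isOpen_inter_preimage hU, ⟨mem_chart_source _ _, hqU⟩,
    fun p => X (φ p), fun p => Y (φ p), fun p hp => ?_⟩
  have := isSolAt_of_isCoordSol hφ hUt hU hs hp.2
  rwa [φ.left_inv hp.1] at this

end Transition

/-! ### Gluing the local solutions and fixing the time orientation. -/

noncomputable section Global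

open Filter Topology

variable {M : Type*} [TopologicalSpace M] [ChartedSpace Plane M] [IsManifold (𝓡 2) ∞ M]
  {g : Metric M} {h : SymTensor M}

theorem exists_isSolAt [SimplyConnectedSpace M] (hcod : IsCodazzi g h)
    (hgauss : IsGaussianCurvature g (fun p => -metricTrace g h p)) :
    ∃ x y : M → L4, ∀ p, IsSolAt g h x y p := by
  have : LocallyPathConnectedSpace M := ChartedSpace.locallyPathConnectedSpace Plane M
  choose U hU hqU x y hsol using fun q : M => exists_isSolAt_nhds hcod hgauss q
  have hev : ∀ i, ∀ q ∈ U i, ∀ᶠ p in 𝓝 q, IsSolAt g h (x i) (y i) p := fun i q hq => by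
    filter_upwards [(hU i).mem_nhds hq] with p hp using hsol i p hp
  have hT : ∀ i j q, ∃ T : lorentzGroup, q ∈ U i ∩ U j →
      ∀ᶠ p in 𝓝 q, T.1 (x i p) = x j p ∧ T.1 (y i p) = y j p := fun i j q => by
    by_cases hq : q ∈ U i ∩ U j
    · obtain ⟨T, hT⟩ := exists_lorentzGroup_eventually_eq (hev i q hq.1) (hev j q hq.2)
      exact ⟨T, fun _ => hT⟩
    · exact ⟨1, fun h => absurd h hq⟩
  choose c hc using hT
  obtain ⟨γ, hγ, hγc⟩ := exists_splitting_of_locallyConstant_cocycle hU id hqU c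
    (fun i j q hq => by
      filter_upwards [(hc i j q hq).eventually_nhds, ((hU i).inter (hU j)).mem_nhds hq]
        with p hp hpU
      refine lorentzGroup_eq_of_eventually (hev i p hpU.1) ?_ ?_
      · filter_upwards [hc i j p hpU, hp] with r h1 h2 using h1.1.trans h2.1.symm
      · filter_upwards [hc i j p hpU, hp] with r h1 h2 using h1.2.trans h2.2.symm)
    (fun i q hq => by
      refine lorentzGroup_eq_of_eventually (hev i q hq) ?_ ?_
      · filter_upwards [hc i i q ⟨hq, hq⟩] with r h1 using h1.1
      · filter_upwards [hc i i q ⟨hq, hq⟩] with r h1 using h1.2)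
    (fun i j k q hq => by
      refine lorentzGroup_eq_of_eventually (hev i q hq.1.1) ?_ ?_
      · filter_upwards [hc i j q hq.1, hc j k q ⟨hq.1.2, hq.2⟩, hc i k q ⟨hq.1.1, hq.2⟩]
          with r h1 h2 h3
        rw [h3.1, ← h2.1, ← h1.1]; rfl
      · filter_upwards [hc i j q hq.1, hc j k q ⟨hq.1.2, hq.2⟩, hc i k q ⟨hq.1.1, hq.2⟩]
          with r h1 h2 h3
        rw [h3.2, ← h2.2, ← h1.2]; rfl)
  -- The glued map uses at each `p` the solution centred at `p`, corrected by `γ p p`. Near `q` the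
  -- splitting relation and local constancy of `γ q` turn it into the single smooth map `γ q q ∘ x
  -- q`.
  have key : ∀ q, ∀ᶠ p in 𝓝 q, (γ p p).1 (x p p) = (γ q q).1 (x q p) ∧
      (γ p p).1 (y p p) = (γ q q).1 (y q p) := fun q => by
    filter_upwards [hγ q q (hqU q), (hU q).mem_nhds (hqU q)] with p hp hpU
    have h1 := (hc q p p ⟨hpU, hqU p⟩).self_of_nhds
    rw [← hp, ← hγc q p p ⟨hpU, hqU p⟩, ← h1.1, ← h1.2]
    exact ⟨rfl, rfl⟩
  refine ⟨fun p => (γ p p).1 (x p p), fun p => (γ p p).1 (y p p), fun q => ?_⟩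
  have := (hsol q q (hqU q)).map
    (LinearMap.toContinuousLinearMap ((γ q q).1 : L4 →ₗ[ℝ] L4)) (γ q q).2
  exact this.congr ((key q).mono fun p hp => hp.1) ((key q).mono fun p hp => hp.2)

/-- Cauchy-Schwarz for the spatial parts gives `(1 + z⁰w⁰)² ≤ (z⁰w⁰)²`, that is, `1 + 2z⁰w⁰ ≤ 0`. -/
theorem zero_mul_zero_neg_of_lorentz_eq_one {z w : L4} (hz : lorentz z z = 0)
    (hw : lorentz w w = 0) (hzw : lorentz z w = 1) : z 0 * w 0 < 0 := by
  simp only [lorentz] at hz hw hzw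
  have hcs : (z 1 * w 1 + z 2 * w 2 + z 3 * w 3) ^ 2
      ≤ (z 1 * z 1 + z 2 * z 2 + z 3 * z 3) * (w 1 * w 1 + w 2 * w 2 + w 3 * w 3) := by
    nlinarith [sq_nonneg (z 1 * w 2 - z 2 * w 1), sq_nonneg (z 1 * w 3 - z 3 * w 1),
      sq_nonneg (z 2 * w 3 - z 3 * w 2)]
  have e1 : z 1 * z 1 + z 2 * z 2 + z 3 * z 3 = z 0 * z 0 := by linarith
  have e2 : w 1 * w 1 + w 2 * w 2 + w 3 * w 3 = w 0 * w 0 := by linarith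
  have e3 : z 1 * w 1 + z 2 * w 2 + z 3 * w 3 = 1 + z 0 * w 0 := by linarith
  rw [e1, e2, e3] at hcs
  nlinarith

theorem injective_mvfderiv_of_metric {x : M → L4} {p : M}
    (hx : ∀ v w : TangentSpace (𝓡 2) p,
      lorentz (mvfderiv (𝓡 2) x p v) (mvfderiv (𝓡 2) x p w) = g.inner p v w) :
    Function.Injective (mvfderiv (𝓡 2) x p) := by
  intro v w hvw
  by_contra hne
  have h1 := g.pos p (v - w) (sub_ne_zero.2 hne)
  rw [← hx, map_sub, hvw, sub_self] at h1
  simp [lorentz] at h1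

/-- Since `x⁰y⁰ < 0`, the function `x⁰` has no zero, so it has constant sign on the connected
surface. If it is negative, the isometry `-1` repairs it. -/
theorem exists_isSolAt_mem_Qplus [SimplyConnectedSpace M] (hcod : IsCodazzi g h)
    (hgauss : IsGaussianCurvature g (fun p => -metricTrace g h p)) :
    ∃ x y : M → L4, (∀ p, IsSolAt g h x y p) ∧ ∀ p, 0 < x p 0 := by
  obtain ⟨x, y, hs⟩ := exists_isSolAt hcod hgauss
  have hne : ∀ p, x p 0 ≠ 0 := fun p h0 => by
    have := zero_mul_zero_neg_of_lorentz_eq_one (hs p).lorentz_fst (hs p).lorentz_snd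
      (hs p).lorentz_eq_one
    simp [h0] at this
  have hcont : Continuous fun p => x p 0 := by
    have : Continuous x := continuous_iff_continuousAt.2 fun p => (hs p).contMDiffAt_fst.continuousAt
    fun_prop
  by_cases hneg : ∃ p, x p 0 < 0
  · obtain ⟨p, hp⟩ := hneg
    refine ⟨fun p => -x p, fun p => -y p, fun p => (hs p).map (-ContinuousLinearMap.id ℝ L4)
      (by simp [lorentz]), fun q => ?_⟩
    by_contra hq
    obtain ⟨r, hr⟩ := mem_range_of_exists_le_of_exists_ge hcont ⟨p, hp.le⟩
      ⟨q, by simpa using hq⟩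
    exact hne r hr
  · push Not at hneg
    exact ⟨x, y, hs, fun p => lt_of_le_of_ne (hneg p) (hne p).symm⟩

theorem exists_isIsometricImmersion [SimplyConnectedSpace M] (hcod : IsCodazzi g h)
    (hgauss : IsGaussianCurvature g (fun p => -metricTrace g h p)) :
    ∃ x : M → L4, IsIsometricImmersion g x ∧ IsSecondFundamentalForm x h := by
  obtain ⟨x, y, hs, hpos⟩ := exists_isSolAt_mem_Qplus hcod hgauss
  refine ⟨x, ⟨fun p => (hs p).contMDiffAt_fst, fun p => ⟨(hs p).lorentz_fst, hpos p⟩,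
    fun p => injective_mvfderiv_of_metric (hs p).metric, fun p => (hs p).metric⟩, y,
    ⟨fun p => (hs p).contMDiffAt_snd, fun p => ⟨(hs p).lorentz_snd, ?_⟩,
      fun p => (hs p).lorentz_eq_one, fun p => (hs p).lorentz_dx, fun p => (hs p).lorentz_dy⟩,
    fun p v w => ((hs p).sff v w).symm⟩
  have := zero_mul_zero_neg_of_lorentz_eq_one (hs p).lorentz_fst (hs p).lorentz_snd
    (hs p).lorentz_eq_one
  exact (pos_iff_neg_of_mul_neg this).1 (hpos p)

end Global

/-! ### Smoothness of a tensor field from its chart components. -/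

noncomputable section Sections

open Filter Topology

set_option maxSynthPendingDepth 3

variable {M : Type*} [TopologicalSpace M] [ChartedSpace Plane M]

theorem bilin_eq_sum (B : Plane →L[ℝ] Plane →L[ℝ] ℝ) :
    B = ∑ i, ∑ j, B (EuclideanSpace.single i 1) (EuclideanSpace.single j 1) •
      (EuclideanSpace.proj i : Plane →L[ℝ] ℝ).smulRight (EuclideanSpace.proj j : Plane →L[ℝ] ℝ) := by
  ext v w
  rw [clm_apply_eq_sum B v, sum_apply]
  simp only [sum_apply, smul_apply, ContinuousLinearMap.smulRight_apply]
  refine Finset.sum_congr rfl fun i _ => ?_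
  rw [clm_apply_eq_sum (B _) w]
  simp
  ring

variable [IsManifold (𝓡 2) ∞ M]

theorem symm_trivializationAt_single {q p : M} (hp : p ∈ (chartAt Plane q).source) (i : Fin 2) :
    (trivializationAt Plane (TangentSpace (𝓡 2)) q).symm p (EuclideanSpace.single i (1 : ℝ) : Plane)
      = (mfderiv (𝓡 2) (𝓡 2) (chartAt Plane q).symm (chartAt Plane q p)
          (EuclideanSpace.single i (1 : ℝ) : Plane) : Plane) := by
  have := TangentBundle.symmL_trivializationAt (𝕜 := ℝ) (I := 𝓡 2) hp
  rw [ModelWithCorners.range_eq_univ, mfderivWithin_univ] at this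
  refine (Bundle.Trivialization.symmL_apply (R := ℝ) _ (by simpa using hp) _).symm.trans ?_
  rw [this]
  rfl

/-- Converse of `contDiffOn_components`: the bundle trivialisation at `q` sends the standard basis
to the coordinate vectors of the chart at `q`, so the local expression of `T` has the chart
components as coefficients. -/
theorem contMDiff_of_contDiffOn_components
    {T : ∀ p : M, TangentSpace (𝓡 2) p →L[ℝ] TangentSpace (𝓡 2) p →L[ℝ] ℝ}
    (hT : ∀ q : M, ∀ i j, ContDiffOn ℝ ∞ (fun u => components T (chartAt Plane q) u i j)
      (chartAt Plane q).target) :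
    ContMDiff (𝓡 2) ((𝓡 2).prod 𝓘(ℝ, Plane →L[ℝ] Plane →L[ℝ] ℝ)) ∞
    (fun p => Bundle.TotalSpace.mk' (Plane →L[ℝ] Plane →L[ℝ] ℝ)
      (E := fun p : M => TangentSpace (𝓡 2) p →L[ℝ] TangentSpace (𝓡 2) p →L[ℝ] ℝ) p (T p)) := by
  intro q
  set φ := chartAt Plane q with hφ
  rw [contMDiffAt_hom_bundle]
  refine ⟨contMDiffAt_id, ?_⟩
  have hs : ∀ i j, ContMDiffAt (𝓡 2) 𝓘(ℝ, ℝ) ∞ (fun p => components T φ (φ p) i j) q := fun i j =>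
    ContMDiffAt.comp q (g := fun u => components T φ u i j) (f := φ)
      ((hT q i j).contDiffAt (φ.open_target.mem_nhds (mem_chart_target _ q))).contMDiffAt
      (contMDiffAt_of_mem_maximalAtlas (IsManifold.chart_mem_maximalAtlas q) (mem_chart_source _ q))
  have key : ContMDiffAt (𝓡 2) 𝓘(ℝ, Plane →L[ℝ] Plane →L[ℝ] ℝ) ∞ (fun p => ∑ i, ∑ j,
      components T φ (φ p) i j • (EuclideanSpace.proj i : Plane →L[ℝ] ℝ).smulRight
        (EuclideanSpace.proj j : Plane →L[ℝ] ℝ)) q :=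
    ContMDiffAt.sum fun i _ => ContMDiffAt.sum fun j _ => (hs i j).smul contMDiffAt_const
  refine key.congr_of_eventuallyEq ?_
  filter_upwards [φ.open_source.mem_nhds (mem_chart_source _ q)] with p hp
  refine (bilin_eq_sum _).trans ?_
  refine Finset.sum_congr rfl fun i _ => Finset.sum_congr rfl fun j _ => ?_
  congr 1
  have := inCoordinates_apply_eq₂ (𝕜 := ℝ) (F₁ := Plane) (F₂ := Plane) (F₃ := ℝ)
    (E₁ := TangentSpace (𝓡 2)) (E₂ := TangentSpace (𝓡 2)) (E₃ := Bundle.Trivial M ℝ)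
    (x₀ := q) (x := p) (ϕ := T p) (v := EuclideanSpace.single i (1 : ℝ))
    (w := EuclideanSpace.single j (1 : ℝ)) (by simpa using hp) (by simpa using hp) (by simp)
  refine Eq.trans this ?_
  -- All tangent spaces are the same type `Plane`, so the base point can be changed in `T` while the
  -- vectors stay fixed.
  have e : ∀ p', p' = p → ∀ v w : Plane, T p v w = T p' v w := by
    rintro _ rfl _ _; rfl
  rw [symm_trivializationAt_single hp, symm_trivializationAt_single hp]
  have l : ∀ r : ℝ, (trivializationAt ℝ (Bundle.Trivial M ℝ) q).linearMapAt ℝ p r = r := by simp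
  exact (l _).trans (e _ (φ.left_inv hp) _ _)

end Sections

/-! ### The dual null vector: formula, uniqueness and smoothness. -/

noncomputable section Dual

open Filter Topology

/-- The null vector `y` with `⟨x, y⟩ = 1` and `⟨a i, y⟩ = 0`, for a null vector `x` with `x⁰ ≠ 0`
and vectors `a 0`, `a 1` orthogonal to `x` with nondegenerate Gram matrix `A`. -/
def dualVec (A : Matrix (Fin 2) (Fin 2) ℝ) (x : L4) (a : Fin 2 → L4) : L4 :=
  let y₁ : L4 := (-(x 0)⁻¹) • EuclideanSpace.single 0 (1 : ℝ)
  let y₂ : L4 := y₁ - ∑ i, ∑ j, (A⁻¹ i j * lorentz y₁ (a j)) • a i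
  y₂ - ((1 / 2 : ℝ) * lorentz y₂ y₂) • x

variable {A : Matrix (Fin 2) (Fin 2) ℝ} {x y y' : L4} {a : Fin 2 → L4}

/-- The time axis is scaled so that its product with `x` is one; then its tangential part is
removed, and a multiple of `x` makes the result null. Since `x` is null and orthogonal to the `a i`,
neither correction disturbs the conditions already achieved. -/
theorem dualVec_spec (hx : lorentz x x = 0) (hx0 : x 0 ≠ 0) (hax : ∀ i, lorentz (a i) x = 0)
    (hA : ∀ i j, lorentz (a i) (a j) = A i j) (hdet : A.det ≠ 0) :
    lorentz (dualVec A x a) (dualVec A x a) = 0 ∧ lorentz x (dualVec A x a) = 1 ∧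
      ∀ i, lorentz (a i) (dualVec A x a) = 0 := by
  set y₁ : L4 := (-(x 0)⁻¹) • EuclideanSpace.single 0 (1 : ℝ) with h₁
  set y₂ : L4 := y₁ - ∑ i, ∑ j, (A⁻¹ i j * lorentz y₁ (a j)) • a i with h₂
  have hd : dualVec A x a = y₂ - ((1 / 2 : ℝ) * lorentz y₂ y₂) • x := rfl
  have e1 : lorentz x y₁ = 1 := by
    simp [h₁, lorentz, hx0]
  have hxa : ∀ i, lorentz x (a i) = 0 := fun i => (lorentz_comm _ _).trans (hax i)
  have e2 : lorentz x y₂ = 1 := by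
    simp only [h₂, lorentz_sub_right, lorentz_sum_right, lorentz_smul_right, hxa, e1, mul_zero,
      Finset.sum_const_zero, sub_zero]
  have e3 : ∀ k, lorentz (a k) y₂ = 0 := fun k => by
    have h1 : ∀ j, ∑ i, A k i * A⁻¹ i j = (1 : Matrix (Fin 2) (Fin 2) ℝ) k j := fun j => by
      rw [← Matrix.mul_nonsing_inv A (isUnit_iff_ne_zero.2 hdet), Matrix.mul_apply]
    have h2 : lorentz (a k) y₂ = lorentz (a k) y₁
        - ∑ j, (∑ i, A k i * A⁻¹ i j) * lorentz y₁ (a j) := by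
      simp only [h₂, lorentz_sub_right, lorentz_sum_right, lorentz_smul_right, hA, Finset.sum_mul]
      rw [Finset.sum_comm]
      congr 1
      exact Finset.sum_congr rfl fun j _ => Finset.sum_congr rfl fun i _ => by ring
    rw [h2]
    simp [h1, Matrix.one_apply, lorentz_comm y₁]
  have e2' : lorentz y₂ x = 1 := (lorentz_comm _ _).trans e2
  rw [hd]
  refine ⟨?_, ?_, fun i => ?_⟩ <;>
    simp only [lorentz_sub_left, lorentz_sub_right, lorentz_smul_left, lorentz_smul_right, e2, e2',
      e3, hx, hax]
  all_goals ring

/-- Pairing with the basis `(x, a 0, a 1, y)` gives `y' = y + ⟨y', y⟩ x`. Since `⟨y', y'⟩` is then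
`2⟨y', y⟩`, nullity forces the coefficient to vanish. -/
theorem eq_of_null_of_lorentz_eq_one (hx : lorentz x x = 0) (hax : ∀ i, lorentz (a i) x = 0)
    (hA : ∀ i j, lorentz (a i) (a j) = A i j) (hdet : A.det ≠ 0) (hy : lorentz y y = 0)
    (hxy : lorentz x y = 1) (hay : ∀ i, lorentz (a i) y = 0) (hy' : lorentz y' y' = 0)
    (hxy' : lorentz x y' = 1) (hay' : ∀ i, lorentz (a i) y' = 0) : y' = y := by
  have hxa : ∀ i, lorentz x (a i) = 0 := fun i => (lorentz_comm _ _).trans (hax i)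
  have hya : ∀ i, lorentz y (a i) = 0 := fun i => (lorentz_comm _ _).trans (hay i)
  have hya' : ∀ i, lorentz y' (a i) = 0 := fun i => (lorentz_comm _ _).trans (hay' i)
  have hyx : lorentz y x = 1 := (lorentz_comm _ _).trans hxy
  have hyx' : lorentz y' x = 1 := (lorentz_comm _ _).trans hxy'
  have hgram : ∀ b c, lorentz (![x, a 0, a 1, y] b) (![x, a 0, a 1, y] c)
      = gramForm (fun _ => A) 0 b c := fun b c => by
    fin_cases b <;> fin_cases c <;> simp [gramForm, hx, hax, hxa, hya, hay, hy, hxy, hyx, hA]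
  have hgd : (gramForm (fun _ => A) 0).det ≠ 0 := by
    rw [det_gramForm]; exact neg_ne_zero.2 hdet
  have key : y' = y + lorentz y' y • x := by
    refine eq_of_lorentz_gram_eq hgram hgd fun b => ?_
    rw [lorentz_add_left, lorentz_smul_left]
    fin_cases b <;> simp [hx, hxa, hya, hya', hy, hxy, hyx, hyx']
  have h0 : lorentz y' y' = 2 * lorentz y' y := by
    conv_lhs => rw [key]
    simp only [lorentz_add_left, lorentz_add_right, lorentz_smul_left, lorentz_smul_right, hx, hy,
      hxy, hyx]
    ring
  have h1 : lorentz y' y = 0 := by linarith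
  rw [key, h1, zero_smul, add_zero]

theorem contDiffOn_dualVec {G : Plane → Matrix (Fin 2) (Fin 2) ℝ} {X : Plane → L4}
    {a : Plane → Fin 2 → L4} {O : Set Plane} (hG : ∀ i j, ContDiffOn ℝ ∞ (fun u => G u i j) O)
    (hdet : ∀ u ∈ O, (G u).det ≠ 0) (hX : ContDiffOn ℝ ∞ X O) (hX0 : ∀ u ∈ O, X u 0 ≠ 0)
    (ha : ∀ i, ContDiffOn ℝ ∞ (fun u => a u i) O) :
    ContDiffOn ℝ ∞ (fun u => dualVec (G u) (X u) (a u)) O := by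
  have h0 : ContDiffOn ℝ ∞ (fun u => X u 0) O :=
    (EuclideanSpace.proj (𝕜 := ℝ) (0 : Fin 4)).contDiff.comp_contDiffOn hX
  have h1 : ContDiffOn ℝ ∞ (fun u => (-(X u 0)⁻¹) • (EuclideanSpace.single 0 (1 : ℝ) : L4)) O :=
    ((h0.inv hX0).neg).smul contDiffOn_const
  have h2 : ContDiffOn ℝ ∞ (fun u => (-(X u 0)⁻¹) • (EuclideanSpace.single 0 (1 : ℝ) : L4)
      - ∑ i, ∑ j, ((G u)⁻¹ i j * lorentz ((-(X u 0)⁻¹) • (EuclideanSpace.single 0 (1 : ℝ) : L4))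
        (a u j)) • a u i) O :=
    h1.sub (ContDiffOn.sum fun i _ => ContDiffOn.sum fun j _ =>
      ((contDiffOn_inv hG hdet i j).mul (contDiffOn_lorentz h1 (ha j))).smul (ha i))
  exact h2.sub ((contDiffOn_const.mul (contDiffOn_lorentz h2 h2)).smul hX)

end Dual

/-! ### The second fundamental form of an isometric immersion and its equations. -/

noncomputable section SecondFundamentalForm

open Filter Topology

variable {M : Type*} [TopologicalSpace M] [ChartedSpace Plane M]
  {φ : OpenPartialHomeomorph M Plane} {u : Plane}

/-- `z` is the value at `p` of the dual of `x`. -/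
def IsDualVec (x : M → L4) (p : M) (z : L4) : Prop :=
  lorentz z z = 0 ∧ lorentz (x p) z = 1 ∧
    ∀ v : TangentSpace (𝓡 2) p, lorentz (mvfderiv (𝓡 2) x p v) z = 0

theorem IsDual.isDualVec {x y : M → L4} (hy : IsDual x y) (p : M) : IsDualVec x p (y p) :=
  ⟨(hy.mem_Qminus p).1, hy.lorentz_eq_one p, hy.lorentz_dx p⟩

theorem lorentz_mvfderiv_eq_zero (hφ : φ ∈ IsManifold.maximalAtlas (𝓡 2) ∞ M) (hu : u ∈ φ.target)
    {x : M → L4} {z : L4}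
    (h : ∀ i, lorentz (mvfderiv (𝓡 2) x (φ.symm u) (coordVec φ i u)) z = 0)
    (v : TangentSpace (𝓡 2) (φ.symm u)) : lorentz (mvfderiv (𝓡 2) x (φ.symm u) v) z = 0 := by
  have := eq_zero_of_coordVec hφ hu (A := (lorentzCLM.flip z).comp
    (mvfderiv (𝓡 2) x (φ.symm u))) (fun i => by simpa using h i)
  simpa using congrArg (fun L => L v) this

theorem contDiffOn_comp_symm {x : M → L4} (hx : ContMDiff (𝓡 2) 𝓘(ℝ, L4) ∞ x)
    (hφ : φ ∈ IsManifold.maximalAtlas (𝓡 2) ∞ M) :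
    ContDiffOn ℝ ∞ (fun w => x (φ.symm w)) φ.target :=
  (hx.comp_contMDiffOn (contMDiffOn_symm_of_mem_maximalAtlas hφ)).contDiffOn

theorem vpd_comp_symm_of_contMDiff {x : M → L4} (hx : ContMDiff (𝓡 2) 𝓘(ℝ, L4) ∞ x)
    (hφ : φ ∈ IsManifold.maximalAtlas (𝓡 2) ∞ M) (hu : u ∈ φ.target) (i : Fin 2) :
    vpd i (fun w => x (φ.symm w)) u = mvfderiv (𝓡 2) x (φ.symm u) (coordVec φ i u) :=
  vpd_comp_symm hφ hu (hx.mdifferentiableAt (by simp)) i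

variable [IsManifold (𝓡 2) ∞ M] {g : Metric M} {x y y' : M → L4} {p : M}

theorem IsIsometricImmersion.lorentz_vpd (hx : IsIsometricImmersion g x)
    (hφ : φ ∈ IsManifold.maximalAtlas (𝓡 2) ∞ M) (hu : u ∈ φ.target) (i j : Fin 2) :
    lorentz (vpd i (fun w => x (φ.symm w)) u) (vpd j (fun w => x (φ.symm w)) u)
      = components g.inner φ u i j := by
  rw [vpd_comp_symm_of_contMDiff hx.contMDiff hφ hu, vpd_comp_symm_of_contMDiff hx.contMDiff hφ hu]
  exact hx.isometric _ _ _

theorem IsIsometricImmersion.lorentz_vpd_self (hx : IsIsometricImmersion g x)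
    (hφ : φ ∈ IsManifold.maximalAtlas (𝓡 2) ∞ M) (hu : u ∈ φ.target) (i : Fin 2) :
    lorentz (vpd i (fun w => x (φ.symm w)) u) (x (φ.symm u)) = 0 :=
  lorentz_vpd_self_eq_zero φ.open_target (contDiffOn_comp_symm hx.contMDiff hφ)
    (fun _ _ => (hx.mem_Qplus _).1) hu i

theorem IsIsometricImmersion.isDualVec_dualVec (hx : IsIsometricImmersion g x)
    (hφ : φ ∈ IsManifold.maximalAtlas (𝓡 2) ∞ M) (hu : u ∈ φ.target) :
    IsDualVec x (φ.symm u) (dualVec (components g.inner φ u) (x (φ.symm u))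
      (fun i => vpd i (fun w => x (φ.symm w)) u)) := by
  obtain ⟨h1, h2, h3⟩ := dualVec_spec (hx.mem_Qplus _).1 (hx.mem_Qplus (φ.symm u)).2.ne'
    (hx.lorentz_vpd_self hφ hu) (hx.lorentz_vpd hφ hu) (det_components_metric_pos g hφ hu).ne'
  refine ⟨h1, h2, lorentz_mvfderiv_eq_zero hφ hu fun i => ?_⟩
  rw [← vpd_comp_symm_of_contMDiff hx.contMDiff hφ hu]
  exact h3 i

theorem IsIsometricImmersion.isDualVec_unique (hx : IsIsometricImmersion g x) {z z' : L4}
    (hz : IsDualVec x p z) (hz' : IsDualVec x p z') : z' = z := by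
  have hφ := IsManifold.chart_mem_maximalAtlas (I := 𝓡 2) (n := ∞) p
  have hu := mem_chart_target Plane p
  rw [← (chartAt Plane p).left_inv (mem_chart_source Plane p)] at hz hz'
  have e := vpd_comp_symm_of_contMDiff hx.contMDiff hφ hu
  exact eq_of_null_of_lorentz_eq_one (hx.mem_Qplus _).1 (hx.lorentz_vpd_self hφ hu)
    (hx.lorentz_vpd hφ hu) (det_components_metric_pos g hφ hu).ne' hz.1 hz.2.1
    (fun i => by rw [e]; exact hz.2.2 _) hz'.1 hz'.2.1 (fun i => by rw [e]; exact hz'.2.2 _)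

theorem IsIsometricImmersion.isDual_unique (hx : IsIsometricImmersion g x) (hy : IsDual x y)
    (hy' : IsDual x y') : y' = y :=
  funext fun p => hx.isDualVec_unique (hy.isDualVec p) (hy'.isDualVec p)

/-- Pointwise uniqueness identifies an arbitrary choice of dual vectors with the explicit smooth
formula in each chart. The lower cone follows from the sign of `x⁰y⁰`, and `⟨dy, x⟩ = 0` from
differentiating `⟨x, y⟩ = 1`. -/
theorem IsIsometricImmersion.exists_isDual (hx : IsIsometricImmersion g x) :
    ∃ y : M → L4, IsDual x y := by
  have hex : ∀ p : M, ∃ z, IsDualVec x p z := fun p => by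
    have := hx.isDualVec_dualVec (IsManifold.chart_mem_maximalAtlas (I := 𝓡 2) (n := ∞) p)
      (mem_chart_target Plane p)
    rw [(chartAt Plane p).left_inv (mem_chart_source Plane p)] at this
    exact ⟨_, this⟩
  choose y hy using hex
  have hsm : ContMDiff (𝓡 2) 𝓘(ℝ, L4) ∞ y := fun q => by
    set φ := chartAt Plane q
    have hφ : φ ∈ IsManifold.maximalAtlas (𝓡 2) ∞ M := IsManifold.chart_mem_maximalAtlas q
    have hX := contDiffOn_comp_symm hx.contMDiff hφ
    have hc := contDiffOn_dualVec (contDiffOn_components g.contMDiff hφ)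
      (fun u hu => (det_components_metric_pos g hφ hu).ne') hX
      (fun u _ => (hx.mem_Qplus (φ.symm u)).2.ne')
      (fun i => contDiffOn_vpd φ.open_target hX i)
    have hq := mem_chart_target Plane q
    have := ContMDiffAt.comp q (f := φ)
      ((hc.contDiffAt (φ.open_target.mem_nhds hq)).contMDiffAt)
      (contMDiffAt_of_mem_maximalAtlas hφ (mem_chart_source _ q))
    refine this.congr_of_eventuallyEq ?_
    filter_upwards [φ.open_source.mem_nhds (mem_chart_source _ q)] with p hp
    have hd := hx.isDualVec_dualVec hφ (φ.map_source hp)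
    rw [φ.left_inv hp] at hd
    simp only [Function.comp_apply]
    rw [φ.left_inv hp]
    exact hx.isDualVec_unique hd (hy p)
  refine ⟨y, hsm, fun p => ⟨(hy p).1, ?_⟩, fun p => (hy p).2.1, fun p => (hy p).2.2, fun p => ?_⟩
  · exact (pos_iff_neg_of_mul_neg (zero_mul_zero_neg_of_lorentz_eq_one (hx.mem_Qplus p).1
      (hy p).1 (hy p).2.1)).1 (hx.mem_Qplus p).2
  · have hφ := IsManifold.chart_mem_maximalAtlas (I := 𝓡 2) (n := ∞) p
    set φ := chartAt Plane p
    have hu : φ p ∈ φ.target := mem_chart_target Plane p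
    have key := lorentz_mvfderiv_eq_zero hφ hu (x := y) (z := x (φ.symm (φ p))) fun i => by
      have dX := differentiableAt_of_contDiffOn φ.open_target
        (contDiffOn_comp_symm hx.contMDiff hφ) hu
      have dY := differentiableAt_of_contDiffOn φ.open_target (contDiffOn_comp_symm hsm hφ) hu
      have := pd_congr φ.open_target hu (fun w _ => (hy (φ.symm w)).2.1) i
      rw [pd_lorentz dX dY, pd_const, vpd_comp_symm_of_contMDiff hx.contMDiff hφ hu,
        (hy _).2.2, zero_add] at this
      rw [← vpd_comp_symm_of_contMDiff hsm hφ hu, lorentz_comm]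
      exact this
    rw [φ.left_inv (mem_chart_source Plane p)] at key
    exact key

/-- Differentiating `⟨∂ᵢx, y⟩ = 0` gives `⟨∂ᵢx, ∂ⱼy⟩ = -⟨∂ⱼ∂ᵢx, y⟩`, which is symmetric in `i` and
`j`. -/
theorem lorentz_mvfderiv_symm (hx : ContMDiff (𝓡 2) 𝓘(ℝ, L4) ∞ x) (hy : IsDual x y) (p : M)
    (v w : TangentSpace (𝓡 2) p) : lorentz (mvfderiv (𝓡 2) x p v) (mvfderiv (𝓡 2) y p w)
      = lorentz (mvfderiv (𝓡 2) x p w) (mvfderiv (𝓡 2) y p v) := by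
  have hφ := IsManifold.chart_mem_maximalAtlas (I := 𝓡 2) (n := ∞) p
  set φ := chartAt Plane p
  have hu : φ p ∈ φ.target := mem_chart_target Plane p
  have hX := contDiffOn_comp_symm hx hφ
  have dY := differentiableAt_of_contDiffOn φ.open_target (contDiffOn_comp_symm hy.contMDiff hφ) hu
  have e : ∀ i j, lorentz (vpd i (fun w => x (φ.symm w)) (φ p))
      (vpd j (fun w => y (φ.symm w)) (φ p))
      = -lorentz (vpd j (vpd i fun w => x (φ.symm w)) (φ p)) (y (φ.symm (φ p))) := fun i j => by
    have dXi := differentiableAt_of_contDiffOn φ.open_target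
      (contDiffOn_vpd φ.open_target hX i) hu
    have := pd_congr φ.open_target hu (fun w hw => show lorentz (vpd i (fun w => x (φ.symm w)) w)
      (y (φ.symm w)) = 0 by
        rw [vpd_comp_symm_of_contMDiff hx hφ hw]; exact hy.lorentz_dx _ _) j
    rw [pd_lorentz dXi dY, pd_const] at this
    linarith
  have key : ∀ v w : TangentSpace (𝓡 2) (φ.symm (φ p)),
      lorentz (mvfderiv (𝓡 2) x (φ.symm (φ p)) v) (mvfderiv (𝓡 2) y (φ.symm (φ p)) w)
      = lorentz (mvfderiv (𝓡 2) x (φ.symm (φ p)) w) (mvfderiv (𝓡 2) y (φ.symm (φ p)) v) := by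
    intro v w
    have := bilin_eq_of_coordVec hφ hu
      (A := pullLorentz (mvfderiv (𝓡 2) x (φ.symm (φ p))) (mvfderiv (𝓡 2) y (φ.symm (φ p))))
      (B := pullLorentz (mvfderiv (𝓡 2) y (φ.symm (φ p))) (mvfderiv (𝓡 2) x (φ.symm (φ p))))
      fun i j => by
        refine (pullLorentz_apply _ _ _ _).trans (Eq.trans ?_ (pullLorentz_apply _ _ _ _).symm)
        refine Eq.trans ?_ (lorentz_comm _ _)
        have e1 := e i j
        rw [vpd_comm φ.open_target hX hu, ← e j i] at e1
        rw [vpd_comp_symm_of_contMDiff hx hφ hu, vpd_comp_symm_of_contMDiff hx hφ hu,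
          vpd_comp_symm_of_contMDiff hy.contMDiff hφ hu,
          vpd_comp_symm_of_contMDiff hy.contMDiff hφ hu] at e1
        exact e1
    have h2 := congrArg (fun L => L v w) this
    exact (pullLorentz_apply _ _ _ _).symm.trans
      (h2.trans ((pullLorentz_apply _ _ _ _).trans (lorentz_comm _ _)))
  rw [φ.left_inv (mem_chart_source Plane p)] at key
  exact key v w

/-- The second fundamental form `-⟨dx, dy⟩`. -/
def secondFundamentalForm (hx : ContMDiff (𝓡 2) 𝓘(ℝ, L4) ∞ x) (hy : IsDual x y) : SymTensor M where
  toFun p := -pullLorentz (mvfderiv (𝓡 2) x p) (mvfderiv (𝓡 2) y p)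
  symm p v w := congrArg Neg.neg ((pullLorentz_apply _ _ _ _).trans
    ((lorentz_mvfderiv_symm hx hy p v w).trans (pullLorentz_apply _ _ _ _).symm))
  contMDiff := contMDiff_of_contDiffOn_components fun q i j => by
    have hφ := IsManifold.chart_mem_maximalAtlas (I := 𝓡 2) (n := ∞) q
    set φ := chartAt Plane q
    refine ContDiffOn.congr (contDiffOn_lorentz
      (contDiffOn_vpd φ.open_target (contDiffOn_comp_symm hx hφ) i)
      (contDiffOn_vpd φ.open_target (contDiffOn_comp_symm hy.contMDiff hφ) j)).neg fun u hu => ?_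
    rw [vpd_comp_symm_of_contMDiff hx hφ hu, vpd_comp_symm_of_contMDiff hy.contMDiff hφ hu]
    exact congrArg Neg.neg (pullLorentz_apply _ _ _ _)

theorem secondFundamentalForm_apply (hx : ContMDiff (𝓡 2) 𝓘(ℝ, L4) ∞ x) (hy : IsDual x y) (p : M)
    (v w : TangentSpace (𝓡 2) p) : (secondFundamentalForm hx hy).toFun p v w
      = -lorentz (mvfderiv (𝓡 2) x p v) (mvfderiv (𝓡 2) y p w) :=
  congrArg Neg.neg (pullLorentz_apply _ _ _ _)

theorem SymTensor.ext_apply {h h' : SymTensor M} (H : ∀ p v w, h.toFun p v w = h'.toFun p v w) :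
    h = h' := by
  have : h.toFun = h'.toFun := funext fun p =>
    ContinuousLinearMap.ext fun v => ContinuousLinearMap.ext fun w => H p v w
  cases h; cases h'; congr

theorem IsIsometricImmersion.isSolAt (hx : IsIsometricImmersion g x) (hy : IsDual x y) (p : M) :
    IsSolAt g (secondFundamentalForm hx.contMDiff hy) x y p :=
  ⟨hx.contMDiff p, hy.contMDiff p, (hx.mem_Qplus p).1, (hy.mem_Qminus p).1, hy.lorentz_eq_one p,
    hy.lorentz_dx p, hy.lorentz_dy p, hx.isometric p,
    fun v w => (secondFundamentalForm_apply hx.contMDiff hy p v w).symm⟩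

variable {h : SymTensor M}

theorem isCodazzi_of_isSolAt (hs : ∀ p, IsSolAt g h x y p) : IsCodazzi g h := by
  intro φ hφ u hu k i j
  have hH := smoothSymOn_symTensor h hφ
  exact ⟨(isCoordSol_of_isSolAt hφ subset_rfl fun u _ => hs _).codazzi φ.open_target
    (smoothSymOn_metric g hφ) hH (fun u hu => (det_components_metric_pos g hφ hu).ne') hu k i j,
    covDerivTensor_symm hH k i j u⟩

theorem isGaussianCurvature_of_isSolAt (hs : ∀ p, IsSolAt g h x y p) :
    IsGaussianCurvature g (fun p => -metricTrace g h p) := by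
  intro φ hφ p hp
  have hu := φ.map_source hp
  have := (isCoordSol_of_isSolAt hφ subset_rfl fun u _ => hs _).gauss φ.open_target
    (smoothSymOn_metric g hφ) (smoothSymOn_symTensor h hφ)
    (fun u hu => (det_components_metric_pos g hφ hu).ne') hu
  rw [← metricTrace_eq g h hφ hu, φ.left_inv hp] at this
  exact this.symm

end SecondFundamentalForm

end LightconeSurface

theorem mainTheorem6 {M : Type*} [TopologicalSpace M] [T2Space M] [SecondCountableTopology M]
    [ChartedSpace LightconeSurface.Plane M] [IsManifold (𝓡 2) ∞ M] [SimplyConnectedSpace M]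
    (g : LightconeSurface.Metric M) :
    (∀ h : LightconeSurface.SymTensor M, LightconeSurface.IsCodazzi g h →
      LightconeSurface.IsGaussianCurvature g (fun p => -LightconeSurface.metricTrace g h p) →
      ∃ x : M → LightconeSurface.L4, LightconeSurface.IsIsometricImmersion g x ∧
        LightconeSurface.IsSecondFundamentalForm x h) ∧
    (∀ x : M → LightconeSurface.L4, LightconeSurface.IsIsometricImmersion g x →
      ∃ h : LightconeSurface.SymTensor M,
        LightconeSurface.IsSecondFundamentalForm x h ∧
        (∀ h' : LightconeSurface.SymTensor M,
          LightconeSurface.IsSecondFundamentalForm x h' → h' = h) ∧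
        LightconeSurface.IsCodazzi g h ∧
        LightconeSurface.IsGaussianCurvature g
          (fun p => -LightconeSurface.metricTrace g h p)) := by
  refine ⟨fun h hcod hgauss => LightconeSurface.exists_isIsometricImmersion hcod hgauss,
    fun x hx => ?_⟩
  obtain ⟨y, hy⟩ := hx.exists_isDual
  refine ⟨LightconeSurface.secondFundamentalForm hx.contMDiff hy,
    ⟨y, hy, LightconeSurface.secondFundamentalForm_apply hx.contMDiff hy⟩, ?_,
    LightconeSurface.isCodazzi_of_isSolAt (hx.isSolAt hy),
    LightconeSurface.isGaussianCurvature_of_isSolAt (hx.isSolAt hy)⟩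
  rintro h' ⟨y', hy', hh'⟩
  obtain rfl := hx.isDual_unique hy hy'
  exact LightconeSurface.SymTensor.ext_apply fun p v w =>
    (hh' p v w).trans (LightconeSurface.secondFundamentalForm_apply hx.contMDiff hy p v w).symm
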